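/- \textbf{Classes of groups.} Let $\Gamma$ be a group and $\mathcal{G}$ a family of groups $G$ with bounded bi-invariant metrics $d$. $\Gamma$ is \emph{$\mathcal{G}$-approximable} if there is $c>0$ such that for every finite $F\subseteq\Gamma$ and $\varepsilon>0$ there are $(G,d)\in\mathcal{G}$ and a map $\varphi:\Gamma\to G$ with $\varphi(e)=e$, with $d(\varphi(gh),\varphi(g)\varphi(h))<\varepsilon$ whenever $g,h,gh\in F$ (\emph{$(F,\varepsilon)$-multiplicativity}), and with $d(\varphi(g),e)>c$ for all $e\ne g\in F$. $\Gamma$ is \emph{sofic}, \emph{$\mathbb{K}$-linear sofic} (for a field $\mathbb{K}$), \emph{hyperlinear} or \emph{weakly sofic} if it is approximable with respect to, respectively, the groups $\mathrm{Sym}(n)$ with the normalized Hamming metric; the groups $\mathrm{GL}_n(\mathbb{K})$ with the metric $\frac1n\mathrm{rk}(M-N)$; the unitary groups $U(n)$ with the normalized Hilbert--Schmidt metric $\big(\frac1n\sum_{i,j}|A_{ij}-B_{ij}|^2\big)^{1/2}$ ($n\ge 1$ in these three cases); all finite groups with bi-invariant metrics of diameter one. \textbf{Sofic actions.} An action of $\Gamma$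 on a set $X$ is \emph{sofic} if for all finite $F\subseteq\Gamma$, $E\subseteq X$ and all $\varepsilon>0$ there are a finite set $A$ and a map $\varphi:\Gamma\to\mathrm{Sym}(A)$ with $\varphi(e)=\mathrm{id}$ which is $(F,\varepsilon)$-multiplicative for the normalized Hamming metric, a finite set $B$, a subset $S\subseteq A$ with $|S|>(1-\varepsilon)|A|$, and injections $\pi_s:E\to B$ ($s\in S$) such that $\pi_{\varphi(g)s}(x)=\pi_s(g^{-1}x)$ whenever $g\in F$, $x\in E$, $s\in S$, $\varphi(g)s\in S$ and $g^{-1}x\in E$. For an action by automorphisms on a (simple) graph $X$, $E$ is instead a finite induced subgraph of $X$, $B$ is a finite graph and the $\pi_s$ are isomorphisms onto induced subgraphs of $B$. \textbf{Haloes.} A \emph{halo of groups} over a set $X$ is a family of groups $L(Y)$, $Y\subseteq X$, with $L(Z)\le L(Y)$ for $Z\subseteq Y$, $L(\emptyset)=1$, $L(X)=\langle L(Y): Y\subseteq X\text{ finite}\rangle$ and $L(Y\cap Z)=L(Y)\cap L(Z)$. A \emph{set-theoretic} (respectively \emph{graph-theoretic}) halo is a functor $\mathcal{L}: X\mapsto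 L(X)$ from sets and injections (respectively graphs and embeddings as induced subgraphs) to groups and monomorphisms such that, for every set (graph) $X$, the images in $L(X)$ of the groups $L(Y)$, for $Y$ a subset (induced subgraph) of $X$, form a halo of groups over (the vertex set of) $X$; these images are again denoted $L(Y)$. We say that $\mathcal{L}$ satisfies (a) and (b) if for every set (graph) $X$: (a) $L(Y\cup Z)=\langle L(Y)\cup L(Z)\rangle$ for all $Y,Z\subseteq X$; (b) for every finite $Y\subseteq X$, every automorphism of $L(Y)$ extends to an automorphism of $L(X)$ that is the identity on $L(X\setminus Y)$. Let $\mathrm{AL}_f(X)$ be the group of all $\beta\in\mathrm{Aut}(L(X))$ such that, for some finite $Y\subseteq X$, $\beta(L(Y))=L(Y)$ and $\beta$ is the identity on $L(X\setminus Y)$. An action of $\Gamma$ on $X$ (by graph automorphisms, in the graph case) induces by functoriality an action on $L(X)$, hence, by conjugation, an action on $\mathrm{AL}_f(X)$; the \emph{automorphic enrichment} is $\mathcal{AL}(\Gamma,X)=\mathrm{AL}_f(X)\rtimes\Gamma$. \textbf{Theorem.} Let $\mathcal{C}$ be the class of sofic groups, of $\mathbb{K}$-linear sofic groups for a field $\mathbb{K}$,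 of hyperlinear groups, or of weakly sofic groups. Let $\Gamma\in\mathcal{C}$ have a sofic action on a set (respectively graph) $X$, and let $\mathcal{L}$ be a set-theoretic (respectively graph-theoretic) halo of groups satisfying (a) and (b). If $\mathrm{AL}_f(X)\in\mathcal{C}$, then $\mathcal{AL}(\Gamma,X)\in\mathcal{C}$. In particular, if $L(Y)$ is finitely generated and residually finite for every finite subset (respectively finite induced subgraph) $Y\subseteq X$, then $\mathrm{AL}_f(X)\in\mathcal{C}$ and $\mathcal{AL}(\Gamma,X)\in\mathcal{C}$. -/

import Mathlib

open scoped Pointwise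

universe u v w k

/-! ## Metric approximations of groups -/

/-- `φ : Γ → G` is `(F, ε)`-multiplicative with respect to the distance function `d` on `G`. -/
def IsMultiplicativeOn {Γ : Type*} [Group Γ] {G : Type*} [Group G] (d : G → G → ℝ)
    (F : Finset Γ) (ε : ℝ) (φ : Γ → G) : Prop :=
  ∀ g ∈ F, ∀ h ∈ F, g * h ∈ F → d (φ (g * h)) (φ g * φ h) < ε

/-- `φ : Γ → G` is `(F, c)`-separating with respect to the distance function `d` on `G`. -/
def IsSeparatingOn {Γ : Type*} [Group Γ] {G : Type*} [Group G] (d : G → G → ℝ)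
    (F : Finset Γ) (c : ℝ) (φ : Γ → G) : Prop :=
  ∀ g ∈ F, g ≠ 1 → c < d (φ g) 1

/-- A family of groups, each of them with a distance function. (The four families used below
consist of bounded bi-invariant metrics.) -/
structure MetricFamily where
  /-- the index set -/
  Idx : Type u
  /-- the groups -/
  carrier : Idx → Type v
  /-- the group structures -/
  group : ∀ i, Group (carrier i)
  /-- the distance functions -/
  d : ∀ i, carrier i → carrier i → ℝ

/-- `Γ` is `𝒢`-approximable: for some `c > 0`, for all finite `F ⊆ Γ` and `ε > 0` there is a unital,
`(F, ε)`-multiplicative, `(F, c)`-separating map from `Γ` to a member of `𝒢`. -/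
def IsApproximable (𝒢 : MetricFamily.{u, v}) (Γ : Type w) [Group Γ] : Prop :=
  ∃ c : ℝ, 0 < c ∧ ∀ (F : Finset Γ) (ε : ℝ), 0 < ε →
    ∃ i : 𝒢.Idx,
      letI := 𝒢.group i
      ∃ φ : Γ → 𝒢.carrier i,
        φ 1 = 1 ∧ IsMultiplicativeOn (𝒢.d i) F ε φ ∧ IsSeparatingOn (𝒢.d i) F c φ

/-- The normalized Hamming metric on `Sym(A)`: the proportion of the points of `A` at which two
permutations differ. -/
noncomputable def permDist {A : Type*} [Fintype A] (σ τ : Equiv.Perm A) : ℝ :=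
  (Nat.card {a : A // σ a ≠ τ a} : ℝ) / Fintype.card A

/-- The normalized rank metric on `GL_n(K)`. -/
noncomputable def rankDist {K : Type*} [Field K] {n : ℕ} (M N : GL (Fin n) K) : ℝ :=
  (((M : Matrix (Fin n) (Fin n) K) - (N : Matrix (Fin n) (Fin n) K)).rank : ℝ) / n

/-- The normalized Hilbert-Schmidt metric on `U(n)`. -/
noncomputable def hsDist {n : ℕ} (A B : Matrix.unitaryGroup (Fin n) ℂ) : ℝ :=
  Real.sqrt ((∑ i, ∑ j,
    ‖(A : Matrix (Fin n) (Fin n) ℂ) i j - (B : Matrix (Fin n) (Fin n) ℂ) i j‖ ^ 2) / n)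

/-- The finite symmetric groups `Sym(n)`, `n ≥ 1`, with the normalized Hamming metric. -/
noncomputable def symFamily : MetricFamily.{0, 0} where
  Idx := ℕ+
  carrier n := Equiv.Perm (Fin n)
  group _ := inferInstance
  d _ := permDist

/-- The groups `GL_n(K)`, `n ≥ 1`, with the normalized rank metric. -/
noncomputable def glFamily (K : Type k) [Field K] : MetricFamily.{0, k} where
  Idx := ℕ+
  carrier n := GL (Fin n) K
  group _ := inferInstance
  d _ := rankDist

/-- The unitary groups `U(n)`, `n ≥ 1`, with the normalized Hilbert-Schmidt metric. -/
noncomputable def unitaryFamily : MetricFamily.{0, 0} where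
  Idx := ℕ+
  carrier n := Matrix.unitaryGroup (Fin n) ℂ
  group _ := inferInstance
  d _ := hsDist

/-- A finite group with a bi-invariant metric of diameter one. -/
structure FiniteMetricGroup where
  /-- the group -/
  carrier : Type
  [group : Group carrier]
  [finite : Finite carrier]
  /-- the metric -/
  d : carrier → carrier → ℝ
  eq_iff : ∀ x y, d x y = 0 ↔ x = y
  symm : ∀ x y, d x y = d y x
  triangle : ∀ x y z, d x z ≤ d x y + d y z
  mul_left : ∀ z x y, d (z * x) (z * y) = d x y
  mul_right : ∀ z x y, d (x * z) (y * z) = d x y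
  le_one : ∀ x y, d x y ≤ 1
  exists_eq_one : ∃ x y, d x y = 1

/-- All finite groups with bi-invariant metrics of diameter one. -/
def finiteFamily : MetricFamily.{1, 0} where
  Idx := FiniteMetricGroup
  carrier H := H.carrier
  group H := H.group
  d H := H.d

/-- The four classes of groups: sofic, `K`-linear sofic for a field `K`, hyperlinear,
weakly sofic. -/
inductive GroupClass : Type (k + 1)
  | sofic : GroupClass
  | linearSofic (K : Type k) [Field K] : GroupClass
  | hyperlinear : GroupClass
  | weaklySofic : GroupClass

/-- The group `Γ` belongs to the class. -/
def GroupClass.Mem : GroupClass.{k} → ∀ (Γ : Type w) [Group Γ], Prop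
  | .sofic, Γ, _ => IsApproximable symFamily Γ
  | @GroupClass.linearSofic K hK, Γ, _ => IsApproximable (@glFamily K hK) Γ
  | .hyperlinear, Γ, _ => IsApproximable unitaryFamily Γ
  | .weaklySofic, Γ, _ => IsApproximable finiteFamily Γ

/-! ## Sofic actions on sets and graphs -/

/-- `φ : Γ → Sym(A)` is an `(F, E, ε)`-orbit approximation of the action of `Γ` on the set `X`. -/
def IsOrbitApproximation {Γ : Type*} [Group Γ] {X : Type*} [MulAction Γ X]
    {A : Type} [Fintype A] (F : Finset Γ) (E : Finset X) (ε : ℝ) (φ : Γ → Equiv.Perm A) : Prop :=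
  ∃ (B : Type) (_ : Finite B) (S : Finset A) (π : S → ({x : X // x ∈ E} ↪ B)),
    (1 - ε) * Fintype.card A < S.card ∧
    ∀ g ∈ F, ∀ (x : X) (hx : x ∈ E) (hgx : g⁻¹ • x ∈ E) (s : A) (hs : s ∈ S) (hgs : φ g s ∈ S),
      π ⟨φ g s, hgs⟩ ⟨x, hx⟩ = π ⟨s, hs⟩ ⟨g⁻¹ • x, hgx⟩

/-- Soficity of an action of a group on a set. -/
def IsSoficAction (Γ : Type*) [Group Γ] (X : Type*) [MulAction Γ X] : Prop :=
  ∀ (F : Finset Γ) (E : Finset X) (ε : ℝ), 0 < ε →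
    ∃ (A : Type) (_ : Fintype A) (φ : Γ → Equiv.Perm A),
      φ 1 = 1 ∧ IsMultiplicativeOn permDist F ε φ ∧ IsOrbitApproximation F E ε φ

/-- The action of `Γ` on the vertices is an action by automorphisms of the graph `X`. -/
def IsGraphAction (Γ : Type*) [Group Γ] {V : Type*} [MulAction Γ V] (X : SimpleGraph V) : Prop :=
  ∀ (g : Γ) (x y : V), X.Adj (g • x) (g • y) ↔ X.Adj x y

/-- `φ : Γ → Sym(A)` is an `(F, E, ε)`-orbit approximation of the action of `Γ` on the graph `X`:
the target is a finite graph, and the injections are inclusions of induced subgraphs. -/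
def IsGraphOrbitApproximation {Γ : Type*} [Group Γ] {V : Type*} [MulAction Γ V]
    (X : SimpleGraph V) {A : Type} [Fintype A] (F : Finset Γ) (E : Finset V) (ε : ℝ)
    (φ : Γ → Equiv.Perm A) : Prop :=
  ∃ (W : Type) (_ : Finite W) (B : SimpleGraph W) (S : Finset A)
    (π : S → (X.induce {x : V | x ∈ E} ↪g B)),
    (1 - ε) * Fintype.card A < S.card ∧
    ∀ g ∈ F, ∀ (x : V) (hx : x ∈ E) (hgx : g⁻¹ • x ∈ E) (s : A) (hs : s ∈ S) (hgs : φ g s ∈ S),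
      π ⟨φ g s, hgs⟩ ⟨x, hx⟩ = π ⟨s, hs⟩ ⟨g⁻¹ • x, hgx⟩

/-- Soficity of an action of a group on a graph. -/
def IsSoficGraphAction (Γ : Type*) [Group Γ] {V : Type*} [MulAction Γ V]
    (X : SimpleGraph V) : Prop :=
  ∀ (F : Finset Γ) (E : Finset V) (ε : ℝ), 0 < ε →
    ∃ (A : Type) (_ : Fintype A) (φ : Γ → Equiv.Perm A),
      φ 1 = 1 ∧ IsMultiplicativeOn permDist F ε φ ∧ IsGraphOrbitApproximation X F E ε φ

/-! ## Haloes of groups over a fixed set, and their finitely supported automorphisms -/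

section Halo

variable {X : Type u} {G : Type v} [Group G]

/-- The family of subgroups `L(Y) ≤ G`, `Y ⊆ X`, is a halo of groups over `X` with `L(X) = G`. -/
structure IsHalo (L : Set X → Subgroup G) : Prop where
  univ : L Set.univ = ⊤
  mono : ∀ Z Y : Set X, Z ⊆ Y → L Z ≤ L Y
  empty : L ∅ = ⊥
  iSup_finite : L Set.univ = ⨆ Y : {Y : Set X // Y.Finite}, L Y
  inter : ∀ Y Z : Set X, L (Y ∩ Z) = L Y ⊓ L Z

/-- Condition (a): `L(Y ∪ Z)` is generated by `L(Y)` and `L(Z)`. -/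
def HaloCondA (L : Set X → Subgroup G) : Prop :=
  ∀ Y Z : Set X, L (Y ∪ Z) = L Y ⊔ L Z

/-- The automorphisms `β` of `G = L(X)` such that `β(L(Y)) = L(Y)` and `β` is the identity on
`L(X \ Y)`. For finite `Y` this is `AL_{f,X}(Y)`. -/
def autSupportedOn (L : Set X → Subgroup G) (Y : Set X) : Set (MulAut G) :=
  {β | (L Y).map β.toMonoidHom = L Y ∧ ∀ x ∈ L Yᶜ, β x = x}

/-- Condition (b): for finite `Y ⊆ X`, every automorphism of `L(Y)` extends to an automorphism of
`L(X)` which is the identity on `L(X \ Y)`. -/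
def HaloCondB (L : Set X → Subgroup G) : Prop :=
  ∀ Y : Set X, Y.Finite → ∀ β : MulAut (L Y),
    ∃ β' ∈ autSupportedOn L Y, ∀ x : L Y, β' (x : G) = (β x : G)

theorem autSupportedOn_mono {L : Set X → Subgroup G} (hL : IsHalo L) (ha : HaloCondA L)
    {Y Z : Set X} (hYZ : Y ⊆ Z) : autSupportedOn L Y ⊆ autSupportedOn L Z := by
  rintro β ⟨h1, h2⟩
  refine ⟨?_, fun x hx => h2 x (hL.mono _ _ (Set.compl_subset_compl.2 hYZ) hx)⟩
  have h3 : (L (Z \ Y)).map β.toMonoidHom = L (Z \ Y) := by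
    have h4 : ∀ x ∈ L (Z \ Y), β x = x := fun x hx =>
      h2 x (hL.mono _ _ (fun _ hz => hz.2) hx)
    ext x
    constructor
    · rintro ⟨y, hy, rfl⟩
      have : β.toMonoidHom y = y := h4 y hy
      rw [this]; exact hy
    · intro hx
      exact ⟨x, hx, h4 x hx⟩
  have h5 : Z = Y ∪ (Z \ Y) := (Set.union_sdiff_cancel hYZ).symm
  rw [h5, ha, Subgroup.map_sup, h1, h3]

/-- The group `AL_f(X)` of finitely supported automorphisms of `L(X)`: those `β` such that, for some
finite `Y ⊆ X`, `β(L(Y)) = L(Y)` and `β` is the identity on `L(X \ Y)`. -/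
def autFin (L : Set X → Subgroup G) (hL : IsHalo L) (ha : HaloCondA L) : Subgroup (MulAut G) where
  carrier := {β | ∃ Y : Set X, Y.Finite ∧ β ∈ autSupportedOn L Y}
  one_mem' := ⟨∅, Set.finite_empty, by
    constructor
    · exact Subgroup.map_id _
    · intro x _; rfl⟩
  mul_mem' := by
    rintro β γ ⟨Y, hY, hβ⟩ ⟨Z, hZ, hγ⟩
    refine ⟨Y ∪ Z, hY.union hZ, ?_⟩
    obtain ⟨h1, h2⟩ := autSupportedOn_mono hL ha Set.subset_union_left hβ
    obtain ⟨h3, h4⟩ := autSupportedOn_mono hL ha Set.subset_union_right hγ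
    refine ⟨?_, fun x hx => ?_⟩
    · have : (β * γ).toMonoidHom = β.toMonoidHom.comp γ.toMonoidHom := rfl
      rw [this, ← Subgroup.map_map, h3, h1]
    · rw [MulAut.mul_apply, h4 x hx, h2 x hx]
  inv_mem' := by
    rintro β ⟨Y, hY, h1, h2⟩
    refine ⟨Y, hY, ?_, fun x hx => ?_⟩
    · have : (β⁻¹).toMonoidHom.comp β.toMonoidHom = MonoidHom.id G := by
        ext x; exact MulAut.inv_apply_self _ _ _
      conv_lhs => rw [← h1]
      rw [Subgroup.map_map, this, Subgroup.map_id]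
    · conv_lhs => rw [← h2 x hx]
      exact MulAut.inv_apply_self _ _ _

variable {Γ : Type w} [Group Γ] [MulAction Γ X]

theorem conj_mem_autFin {L : Set X → Subgroup G} (hL : IsHalo L) (ha : HaloCondA L)
    (a : Γ →* MulAut G) (h : ∀ (g : Γ) (Y : Set X), (L Y).map (a g).toMonoidHom = L (g • Y))
    (g : Γ) {β : MulAut G} (hβ : β ∈ autFin L hL ha) : a g * β * (a g)⁻¹ ∈ autFin L hL ha := by
  obtain ⟨Y, hY, h1, h2⟩ := hβ
  refine ⟨g • Y, hY.smul_set, ?_, fun x hx => ?_⟩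
  · have e : (a g * β * (a g)⁻¹).toMonoidHom.comp (a g).toMonoidHom =
        (a g).toMonoidHom.comp β.toMonoidHom := by
      ext x
      change a g (β ((a g)⁻¹ (a g x))) = a g (β x)
      rw [MulAut.inv_apply_self]
    rw [← h g Y, Subgroup.map_map, e, ← Subgroup.map_map, h1]
  · rw [← Set.smul_set_compl, ← h g Yᶜ] at hx
    obtain ⟨y, hy, rfl⟩ := hx
    change a g (β ((a g)⁻¹ (a g y))) = a g y
    rw [MulAut.inv_apply_self, h2 y hy]

/-- The action of `Γ` on `AL_f(X)` by conjugation, induced by an action `a` of `Γ` on `L(X)` with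
`a(g)(L(Y)) = L(gY)`. -/
def autFinAction (L : Set X → Subgroup G) (hL : IsHalo L) (ha : HaloCondA L)
    (a : Γ →* MulAut G) (h : ∀ (g : Γ) (Y : Set X), (L Y).map (a g).toMonoidHom = L (g • Y)) :
    Γ →* MulAut (autFin L hL ha) where
  toFun g :=
    { toFun := fun β => ⟨a g * β * (a g)⁻¹, conj_mem_autFin hL ha a h g β.2⟩
      invFun := fun β => ⟨a g⁻¹ * β * (a g⁻¹)⁻¹, conj_mem_autFin hL ha a h g⁻¹ β.2⟩
      left_inv := fun β => Subtype.ext (by simp [mul_assoc])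
      right_inv := fun β => Subtype.ext (by simp [mul_assoc])
      map_mul' := fun β γ => Subtype.ext (by simp [mul_assoc]) }
  map_one' := by ext β; simp
  map_mul' g₁ g₂ := by ext β; simp [mul_assoc]

end Halo

/-! ## Set-theoretic haloes -/

/-- A set-theoretic halo of groups: a functor from sets and injections to groups and monomorphisms,
such that over every set `X` the images of the `L(Y)`, `Y ⊆ X`, form a halo of groups. -/
structure SetHalo where
  /-- the group `L(X)` -/
  obj : Type u → Type v
  [group : ∀ X, Group (obj X)]
  /-- the homomorphism induced by an injection -/
  map : ∀ {Y X : Type u}, (Y ↪ X) → (obj Y →* obj X)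
  map_injective : ∀ {Y X : Type u} (f : Y ↪ X), Function.Injective (map f)
  map_refl : ∀ X : Type u, map (Function.Embedding.refl X) = MonoidHom.id (obj X)
  map_trans : ∀ {Z Y X : Type u} (f : Z ↪ Y) (g : Y ↪ X),
    map (f.trans g) = (map g).comp (map f)
  isHalo : ∀ X : Type u,
    IsHalo fun Y : Set X => (map (Function.Embedding.subtype fun x => x ∈ Y)).range

attribute [instance] SetHalo.group

namespace SetHalo

variable (𝓛 : SetHalo.{u, v})

/-- The subgroup `L(Y) ≤ L(X)` for `Y ⊆ X`. -/
def sub {X : Type u} (Y : Set X) : Subgroup (𝓛.obj X) :=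
  (𝓛.map (Function.Embedding.subtype fun x => x ∈ Y)).range

/-- Condition (a), over every set. -/
def CondA : Prop := ∀ X : Type u, HaloCondA (𝓛.sub (X := X))

/-- Condition (b), over every set. -/
def CondB : Prop := ∀ X : Type u, HaloCondB (𝓛.sub (X := X))

/-- The automorphism of `L(X)` induced by a permutation of `X`. -/
def mapEquiv {X : Type u} (e : X ≃ X) : MulAut (𝓛.obj X) where
  toFun := 𝓛.map e.toEmbedding
  invFun := 𝓛.map e.symm.toEmbedding
  left_inv x := by
    rw [← MonoidHom.comp_apply, ← 𝓛.map_trans]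
    have : e.toEmbedding.trans e.symm.toEmbedding = Function.Embedding.refl X := by ext; simp
    rw [this, 𝓛.map_refl]; rfl
  right_inv x := by
    rw [← MonoidHom.comp_apply, ← 𝓛.map_trans]
    have : e.symm.toEmbedding.trans e.toEmbedding = Function.Embedding.refl X := by ext; simp
    rw [this, 𝓛.map_refl]; rfl
  map_mul' := map_mul _

/-- The action of `Γ` on `L(X)` induced by an action on `X`. -/
def action (Γ : Type w) [Group Γ] (X : Type u) [MulAction Γ X] : Γ →* MulAut (𝓛.obj X) where
  toFun g := 𝓛.mapEquiv (MulAction.toPerm g)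
  map_one' := by
    ext x
    change 𝓛.map (MulAction.toPerm (1 : Γ)).toEmbedding x = x
    have : (MulAction.toPerm (1 : Γ)).toEmbedding = Function.Embedding.refl X := by ext; simp
    rw [this, 𝓛.map_refl]; rfl
  map_mul' g h := by
    ext x
    change 𝓛.map (MulAction.toPerm (g * h)).toEmbedding x =
      𝓛.map (MulAction.toPerm g).toEmbedding (𝓛.map (MulAction.toPerm h).toEmbedding x)
    have : (MulAction.toPerm (g * h) : Equiv.Perm X).toEmbedding =
        (MulAction.toPerm h).toEmbedding.trans (MulAction.toPerm g).toEmbedding := by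
      ext; simp [mul_smul]
    rw [this, 𝓛.map_trans]; rfl

theorem action_map_sub (Γ : Type w) [Group Γ] (X : Type u) [MulAction Γ X] (g : Γ) (Y : Set X) :
    (𝓛.sub Y).map (𝓛.action Γ X g).toMonoidHom = 𝓛.sub (g • Y) := by
  have key : ∀ (g : Γ) (Y : Set X),
      (𝓛.sub Y).map (𝓛.action Γ X g).toMonoidHom ≤ 𝓛.sub (g • Y) := by
    rintro g Y _ ⟨_, ⟨y, rfl⟩, rfl⟩
    let f : Y ↪ (g • Y : Set X) :=
      ⟨fun y => ⟨g • (y : X), Set.smul_mem_smul_set y.2⟩, fun a b hab => by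
        simpa [Subtype.ext_iff] using hab⟩
    refine ⟨𝓛.map f y, ?_⟩
    change 𝓛.map _ (𝓛.map f y) = 𝓛.map (MulAction.toPerm g).toEmbedding (𝓛.map _ y)
    rw [← MonoidHom.comp_apply, ← MonoidHom.comp_apply, ← 𝓛.map_trans, ← 𝓛.map_trans]
    rfl
  refine le_antisymm (key g Y) fun x hx => ?_
  refine ⟨𝓛.action Γ X g⁻¹ x, ?_, ?_⟩
  · have := key g⁻¹ (g • Y) ⟨x, hx, rfl⟩
    rwa [inv_smul_smul] at this
  · change 𝓛.action Γ X g (𝓛.action Γ X g⁻¹ x) = x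
    rw [← MulAut.mul_apply, ← map_mul]; simp

/-- The group `AL_f(X)`. -/
abbrev AutFin (ha : 𝓛.CondA) (X : Type u) : Type v :=
  autFin (𝓛.sub (X := X)) (𝓛.isHalo X) (ha X)

/-- The automorphic enrichment `AL_f(X) ⋊ Γ` of an action of `Γ` on `X`. -/
abbrev AutEnrichment (ha : 𝓛.CondA) (Γ : Type w) [Group Γ] (X : Type u) [MulAction Γ X] :
    Type (max v w) :=
  𝓛.AutFin ha X ⋊[autFinAction (𝓛.sub (X := X)) (𝓛.isHalo X) (ha X) (𝓛.action Γ X)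
    (𝓛.action_map_sub Γ X)] Γ

end SetHalo

/-! ## Graph-theoretic haloes -/

/-- A graph-theoretic halo of groups: a functor from graphs and inclusions of induced subgraphs to
groups and monomorphisms, such that over every graph `X` the images of the `L(Y)`, `Y` an induced
subgraph of `X`, form a halo of groups. -/
structure GraphHalo where
  /-- the group `L(X)` -/
  obj : ∀ {V : Type u}, SimpleGraph V → Type v
  [group : ∀ {V : Type u} (X : SimpleGraph V), Group (obj X)]
  /-- the homomorphism induced by an inclusion of an induced subgraph -/
  map : ∀ {W V : Type u} {Y : SimpleGraph W} {X : SimpleGraph V}, (Y ↪g X) → (obj Y →* obj X)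
  map_injective : ∀ {W V : Type u} {Y : SimpleGraph W} {X : SimpleGraph V} (f : Y ↪g X),
    Function.Injective (map f)
  map_refl : ∀ {V : Type u} (X : SimpleGraph V),
    map (SimpleGraph.Embedding.refl (G := X)) = MonoidHom.id (obj X)
  map_comp : ∀ {U W V : Type u} {Z : SimpleGraph U} {Y : SimpleGraph W} {X : SimpleGraph V}
    (g : Y ↪g X) (f : Z ↪g Y), map (g.comp f) = (map g).comp (map f)
  isHalo : ∀ {V : Type u} (X : SimpleGraph V),
    IsHalo fun Y : Set V => (map (SimpleGraph.Embedding.induce (G := X) Y)).range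

attribute [instance] GraphHalo.group

namespace GraphHalo

variable (𝓛 : GraphHalo.{u, v})

/-- The subgroup `L(Y) ≤ L(X)` for the subgraph `Y` of `X` induced on a set of vertices. -/
def sub {V : Type u} (X : SimpleGraph V) (Y : Set V) : Subgroup (𝓛.obj X) :=
  (𝓛.map (SimpleGraph.Embedding.induce (G := X) Y)).range

/-- Condition (a), over every graph. -/
def CondA : Prop := ∀ (V : Type u) (X : SimpleGraph V), HaloCondA (𝓛.sub X)

/-- Condition (b), over every graph. -/
def CondB : Prop := ∀ (V : Type u) (X : SimpleGraph V), HaloCondB (𝓛.sub X)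

/-- The automorphism of `L(X)` induced by an automorphism of `X`. -/
def mapIso {V : Type u} {X : SimpleGraph V} (e : X ≃g X) : MulAut (𝓛.obj X) where
  toFun := 𝓛.map e.toEmbedding
  invFun := 𝓛.map e.symm.toEmbedding
  left_inv x := by
    rw [← MonoidHom.comp_apply, ← 𝓛.map_comp]
    have : e.symm.toEmbedding.comp e.toEmbedding = SimpleGraph.Embedding.refl (G := X) := by
      ext; simp
    rw [this, 𝓛.map_refl]; rfl
  right_inv x := by
    rw [← MonoidHom.comp_apply, ← 𝓛.map_comp]
    have : e.toEmbedding.comp e.symm.toEmbedding = SimpleGraph.Embedding.refl (G := X) := by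
      ext; simp
    rw [this, 𝓛.map_refl]; rfl
  map_mul' := map_mul _

/-- The graph automorphism given by an element of a group acting on the graph. -/
def actIso {Γ : Type w} [Group Γ] {V : Type u} [MulAction Γ V] {X : SimpleGraph V}
    (hX : IsGraphAction Γ X) (g : Γ) : X ≃g X where
  toEquiv := MulAction.toPerm g
  map_rel_iff' := fun {x y} => hX g x y

/-- The action of `Γ` on `L(X)` induced by an action on the graph `X`. -/
def action {Γ : Type w} [Group Γ] {V : Type u} [MulAction Γ V] {X : SimpleGraph V}
    (hX : IsGraphAction Γ X) : Γ →* MulAut (𝓛.obj X) where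
  toFun g := 𝓛.mapIso (actIso hX g)
  map_one' := by
    ext x
    change 𝓛.map (actIso hX 1).toEmbedding x = x
    have : (actIso hX 1).toEmbedding = SimpleGraph.Embedding.refl (G := X) := by
      ext v; exact one_smul Γ v
    rw [this, 𝓛.map_refl]; rfl
  map_mul' g h := by
    ext x
    change 𝓛.map (actIso hX (g * h)).toEmbedding x =
      𝓛.map (actIso hX g).toEmbedding (𝓛.map (actIso hX h).toEmbedding x)
    have : (actIso hX (g * h)).toEmbedding =
        (actIso hX g).toEmbedding.comp (actIso hX h).toEmbedding := by
      ext v; exact mul_smul g h v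
    rw [this, 𝓛.map_comp]; rfl

theorem action_map_sub {Γ : Type w} [Group Γ] {V : Type u} [MulAction Γ V] {X : SimpleGraph V}
    (hX : IsGraphAction Γ X) (g : Γ) (Y : Set V) :
    (𝓛.sub X Y).map (𝓛.action hX g).toMonoidHom = 𝓛.sub X (g • Y) := by
  have key : ∀ (g : Γ) (Y : Set V),
      (𝓛.sub X Y).map (𝓛.action hX g).toMonoidHom ≤ 𝓛.sub X (g • Y) := by
    rintro g Y _ ⟨_, ⟨y, rfl⟩, rfl⟩
    let f : X.induce Y ↪g X.induce (g • Y : Set V) :=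
      { toFun := fun y => ⟨g • (y : V), Set.smul_mem_smul_set y.2⟩
        inj' := fun a b hab => by simpa [Subtype.ext_iff] using hab
        map_rel_iff' := fun {a b} => hX g a b }
    refine ⟨𝓛.map f y, ?_⟩
    change 𝓛.map _ (𝓛.map f y) = 𝓛.map (actIso hX g).toEmbedding (𝓛.map _ y)
    rw [← MonoidHom.comp_apply, ← MonoidHom.comp_apply, ← 𝓛.map_comp, ← 𝓛.map_comp]
    rfl
  refine le_antisymm (key g Y) fun x hx => ?_
  refine ⟨𝓛.action hX g⁻¹ x, ?_, ?_⟩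
  · have := key g⁻¹ (g • Y) ⟨x, hx, rfl⟩
    rwa [inv_smul_smul] at this
  · change 𝓛.action hX g (𝓛.action hX g⁻¹ x) = x
    rw [← MulAut.mul_apply, ← map_mul]; simp

/-- The group `AL_f(X)`. -/
abbrev AutFin (ha : 𝓛.CondA) {V : Type u} (X : SimpleGraph V) : Type v :=
  autFin (𝓛.sub X) (𝓛.isHalo X) (ha V X)

/-- The automorphic enrichment `AL_f(X) ⋊ Γ` of an action of `Γ` on the graph `X`. -/
abbrev AutEnrichment (ha : 𝓛.CondA) {Γ : Type w} [Group Γ] {V : Type u} [MulAction Γ V]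
    {X : SimpleGraph V} (hX : IsGraphAction Γ X) : Type (max v w) :=
  𝓛.AutFin ha X ⋊[autFinAction (𝓛.sub X) (𝓛.isHalo X) (ha V X) (𝓛.action hX)
    (𝓛.action_map_sub hX)] Γ

end GraphHalo

/-! ## Families of metric groups closed under wreath products -/

-- The enrichment is a semidirect product `N ⋊ Γ` with `N` = AL_f(X). The argument separates a
-- statement about semidirect products from one about haloes.
--
-- Suppose the action of `Γ` on `N` is modelled by permutations `φ g` of a finite set `A` and
-- injective endomorphisms `θ a` of `N` with `θ (φ g a) (g · β) = θ a β` for most `a`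
-- (`IsSoficAutAction`). If `χ` approximates `N` by `G`, send `(β, g)` to the element of the wreath
-- product of `G` with Sym(A) that has permutation `φ g` and coordinates `χ (θ (φ g a) β)`. The
-- intertwining relation is exactly what makes this almost multiplicative, and injectivity of `θ a`
-- separates the elements `(β, 1)`. A second factor `ψ g`, from an approximation of `Γ`, separates
-- the others. This is `IsApproximable.semidirectProduct`; it needs only target families that absorb
-- wreath products and products. Symmetric groups do so by imprimitive actions, linear and unitary
-- groups by block monomial matrices, finite metric groups by averaging the metric over `A`. In the
-- unitary case the squared distance is used, because it is additive over column blocks.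
--
-- For a halo, (a) makes L(X) generated by the groups of points. Hence conjugating an automorphism
-- supported on `Y` by one that permutes the point groups depends only on the permutation restricted
-- to `Y` (`CoversPerm.conj_eq_conj`). If `X` is infinite, the target `B` of a sofic approximation
-- is embedded in `X` merely as a set. Each injection `E → B → X` extends to a product of
-- transpositions, and each transposition lifts to L(X): by functoriality for sets, by (b) for
-- graphs, even when it is no graph automorphism (`GraphHalo.exists_coversPerm_swap`). Conjugation
-- by the lifts gives the `θ a`. If `X` is finite, the regular representation of Sym(X) replaces the
-- approximation.
--
-- For the last assertion, finitely many elements of AL_f(X) have a common finite support `Z` and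
-- are determined by their restrictions to L(Z). The automorphism group of a finitely generated
-- residually finite group is residually finite, so AL_f(X) looks locally like a finite group.

attribute [instance] MetricFamily.group

/-- The upper and lower metric estimates for a realisation `W` of the permutational wreath product
`G ≀ Sym(A)` by block monomial elements of a group `H`. -/
structure IsWreathMap {G H : Type*} [Group G] [Group H] (dG : G → G → ℝ) (dH : H → H → ℝ)
    {A : Type} [Fintype A] (W : (A → G) → Equiv.Perm A → H) : Prop where
  map_one : W 1 1 = 1
  map_mul : ∀ f σ f' σ', W f σ * W f' σ' = W (fun a => f (σ' a) * f' a) (σ * σ')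
  -- `t a` is the cost charged to the column block `a`. A cost of at least 4 imposes no condition: 4
  -- bounds the contribution of any column block in all the families used, the worst case being the
  -- squared Hilbert-Schmidt distance.
  upper : ∀ (f : A → G) (σ : Equiv.Perm A) (f' : A → G) (σ' : Equiv.Perm A) (t : A → ℝ),
    (∀ a, 0 ≤ t a) → (∀ a, t a < 4 → σ a = σ' a ∧ dG (f a) (f' a) ≤ t a) →
    dH (W f σ) (W f' σ') ≤ (∑ a, t a) / Fintype.card A
  lower : ∀ f : A → G, (∑ a, dG (f a) 1) / Fintype.card A ≤ dH (W f 1) 1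

/-- A family of groups with distance functions is closed under wreath products with finite symmetric
groups, and under products, and contains the finite groups. -/
structure MetricFamily.IsWreathClosed (𝒢 : MetricFamily.{u, v}) : Prop where
  nonneg : ∀ i x y, 0 ≤ 𝒢.d i x y
  self_eq_zero : ∀ i x, 𝒢.d i x x = 0
  wreath : ∀ (i : 𝒢.Idx) (A : Type) [Fintype A] [Nonempty A],
    ∃ (j : 𝒢.Idx) (W : (A → 𝒢.carrier i) → Equiv.Perm A → 𝒢.carrier j),
      IsWreathMap (𝒢.d i) (𝒢.d j) W
  prod : ∀ i j : 𝒢.Idx, ∃ (l : 𝒢.Idx) (ι : 𝒢.carrier i × 𝒢.carrier j →* 𝒢.carrier l),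
    (∀ x y, 𝒢.d l (ι x) (ι y) ≤ 𝒢.d i x.1 y.1 + 𝒢.d j x.2 y.2) ∧
    (∀ x, 𝒢.d i x.1 1 / 2 ≤ 𝒢.d l (ι x) 1 ∧ 𝒢.d j x.2 1 / 2 ≤ 𝒢.d l (ι x) 1)
  perm : ∀ n : ℕ, ∃ (l : 𝒢.Idx) (ι : Equiv.Perm (Fin n) →* 𝒢.carrier l),
    ∀ σ, σ ≠ 1 → 1 / 2 ≤ 𝒢.d l (ι σ) 1

/-- A group which on finite subsets looks like a finite group is approximable. -/
theorem IsApproximable.of_locallyEmbeddable {𝒢 : MetricFamily.{u, v}} (h𝒢 : 𝒢.IsWreathClosed)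
    {Λ : Type w} [Group Λ]
    (h : ∀ F : Finset Λ, ∃ (n : ℕ) (φ : Λ → Equiv.Perm (Fin n)), φ 1 = 1 ∧
      (∀ x ∈ F, ∀ y ∈ F, x * y ∈ F → φ (x * y) = φ x * φ y) ∧ ∀ x ∈ F, x ≠ 1 → φ x ≠ 1) :
    IsApproximable 𝒢 Λ := by
  refine ⟨1 / 4, by norm_num, fun F ε hε => ?_⟩
  obtain ⟨n, φ, h1, hmul, hsep⟩ := h F
  obtain ⟨l, ι, hι⟩ := h𝒢.perm n
  refine ⟨l, fun x => ι (φ x), ?_, ?_, ?_⟩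
  · show ι (φ 1) = 1
    rw [h1, _root_.map_one]
  · intro x hx y hy hxy
    show 𝒢.d l (ι (φ (x * y))) (ι (φ x) * ι (φ y)) < ε
    rw [hmul x hx y hy hxy, _root_.map_mul, h𝒢.self_eq_zero]
    exact hε
  · intro x hx hx1
    have := hι _ (hsep x hx hx1)
    show 1 / 4 < 𝒢.d l (ι (φ x)) 1
    linarith

/-! ### Semidirect products by sofic actions -/

/-- `Γ` acts soficly on `N`: the action is approximated by permutations `φ(g)` of finite sets `A`,
together with embeddings `θ a : N → N`, `a ∈ A`, intertwining the action and the permutations. -/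
def IsSoficAutAction {N : Type*} {Γ : Type*} [Group N] [Group Γ] (act : Γ →* MulAut N) : Prop :=
  ∀ (F : Finset Γ) (P : Finset N) (ε : ℝ), 0 < ε →
    ∃ (A : Type) (_ : Fintype A) (φ : Γ → Equiv.Perm A) (S : Finset A) (θ : A → N →* N),
      φ 1 = 1 ∧ IsMultiplicativeOn permDist F ε φ ∧ (1 - ε) * Fintype.card A < S.card ∧
      (∀ a, Function.Injective (θ a)) ∧
      ∀ g ∈ F, ∀ β ∈ P, ∀ s ∈ S, φ g s ∈ S → θ (φ g s) (act g β) = θ s β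

theorem card_filter_div {A : Type*} [Fintype A] (σ τ : Equiv.Perm A)
    [DecidablePred fun a => σ a ≠ τ a] :
    ((Finset.univ.filter fun a => σ a ≠ τ a).card : ℝ) / Fintype.card A = permDist σ τ := by
  unfold permDist
  rw [Nat.card_eq_fintype_card, Fintype.card_subtype]

/-- At a point `a` with `φ (gh) a = φ g (φ h a)` and with both `φ h a` and `φ g (φ h a)` in `S`, the
relation for `θ` turns the factor `θ (φ g (φ h a)) (g · γ)` of the product into `θ (φ h a) γ`, the
coordinate prescribed by `(γ, h)`. The remaining points have small density. -/
theorem IsApproximable.semidirectProduct {𝒢 : MetricFamily.{u, v}} (h𝒢 : 𝒢.IsWreathClosed)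
    {N : Type*} {Γ : Type*} [Group N] [Group Γ] (act : Γ →* MulAut N)
    (hN : IsApproximable 𝒢 N) (hΓ : IsApproximable 𝒢 Γ) (hact : IsSoficAutAction act) :
    IsApproximable 𝒢 (N ⋊[act] Γ) := by
  classical
  obtain ⟨c, hc, hN⟩ := hN
  obtain ⟨c', hc', hΓ⟩ := hΓ
  -- The factor 1/2 is lost in the embedding of a product of two members of the family into a third.
  refine ⟨min c c' / 2, by positivity, fun F ε hε => ?_⟩
  set FΓ : Finset Γ := F.image fun x => x.right
  set P : Finset N := F.image fun x => x.left
  have hFΓ : ∀ x ∈ F, x.right ∈ FΓ := fun x hx => Finset.mem_image_of_mem _ hx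
  have hP : ∀ x ∈ F, x.left ∈ P := fun x hx => Finset.mem_image_of_mem _ hx
  -- Three exceptional sets of density at most `ε / 40`, at cost 4 per point, contribute `3ε / 10`.
  -- With `ε / 4` from `χ` and `ε / 4` from `ψ` the total stays below `ε`.
  obtain ⟨A, _, φ, S, θ, hφ1, hφ, hS, hθ, hθact⟩ := hact FΓ P (ε / 40) (by positivity)
  have hA : Nonempty A := by
    by_contra hA
    rw [not_nonempty_iff] at hA
    simp [Finset.eq_empty_of_isEmpty S] at hS
  have hcA : (0 : ℝ) < Fintype.card A := by exact_mod_cast Fintype.card_pos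
  obtain ⟨j, ψ, hψ1, hψ, hψs⟩ := hΓ FΓ (ε / 4) (by positivity)
  -- The approximation `χ` of `N` is chosen after `A` and `θ`, since it has to be good on all the
  -- images under the `θ a` that occur as factors or products.
  set Q : Finset N := Finset.univ.biUnion fun a : A =>
    P.image (θ a) ∪ (FΓ ×ˢ P).image fun x => θ a (act x.1 x.2)
  have hQ1 : ∀ a, ∀ β ∈ P, θ a β ∈ Q := fun a β hβ => by
    simp only [Q, Finset.mem_biUnion, Finset.mem_univ, true_and, Finset.mem_union]
    exact ⟨a, Or.inl (Finset.mem_image_of_mem _ hβ)⟩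
  have hQ2 : ∀ a, ∀ g ∈ FΓ, ∀ β ∈ P, θ a (act g β) ∈ Q := fun a g hg β hβ => by
    simp only [Q, Finset.mem_biUnion, Finset.mem_univ, true_and, Finset.mem_union]
    exact ⟨a, Or.inr (Finset.mem_image.2 ⟨(g, β), Finset.mk_mem_product hg hβ, rfl⟩)⟩
  obtain ⟨i, χ, hχ1, hχ, hχs⟩ := hN Q (ε / 4) (by positivity)
  obtain ⟨i', W, hW⟩ := h𝒢.wreath i A
  obtain ⟨l, ι, hι, hι'⟩ := h𝒢.prod i' j
  let f : N ⋊[act] Γ → A → 𝒢.carrier i := fun x a => χ (θ (φ x.right a) x.left)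
  refine ⟨l, fun x => ι (W (f x) (φ x.right), ψ x.right), ?_, ?_, ?_⟩
  · have : f 1 = 1 := by
      funext a
      simp [f, hχ1]
    show ι (W (f 1) (φ 1), ψ 1) = 1
    rw [this, hφ1, hW.map_one, hψ1]
    exact _root_.map_one ι
  · intro x hx y hy hxy
    show 𝒢.d l (ι (W (f (x * y)) (φ (x * y).right), ψ (x * y).right))
      (ι (W (f x) (φ x.right), ψ x.right) * ι (W (f y) (φ y.right), ψ y.right)) < ε
    rw [← _root_.map_mul]
    refine (hι _ _).trans_lt ?_
    have h1 : 𝒢.d j (ψ (x * y).right) (ψ x.right * ψ y.right) < ε / 4 :=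
      hψ _ (hFΓ x hx) _ (hFΓ y hy) (hFΓ _ hxy)
    -- the exceptional points
    let T : Finset A := (Finset.univ.filter fun a => φ (x * y).right a ≠ (φ x.right * φ y.right) a) ∪
      (Sᶜ.map (φ y.right)⁻¹.toEmbedding ∪ Sᶜ.map (φ x.right * φ y.right)⁻¹.toEmbedding)
    have hT : (T.card : ℝ) ≤ 3 * (ε / 40) * Fintype.card A := by
      have e1 : (T.card : ℝ) ≤
          (Finset.univ.filter fun a => φ (x * y).right a ≠ (φ x.right * φ y.right) a).card +
          ((Sᶜ.card : ℝ) + Sᶜ.card) := by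
        have := (Finset.card_union_le _ _ : T.card ≤ _)
        have h2 := Finset.card_union_le (Sᶜ.map (φ y.right)⁻¹.toEmbedding)
          (Sᶜ.map (φ x.right * φ y.right)⁻¹.toEmbedding)
        rw [Finset.card_map, Finset.card_map] at h2
        exact_mod_cast this.trans (Nat.add_le_add_left h2 _)
      have e2 := hφ _ (hFΓ x hx) _ (hFΓ y hy) (hFΓ _ hxy)
      change permDist (φ (x * y).right) (φ x.right * φ y.right) < ε / 40 at e2
      rw [← card_filter_div, div_lt_iff₀ hcA] at e2
      have e3 : (Sᶜ.card : ℝ) = Fintype.card A - S.card := by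
        rw [Finset.card_compl, Nat.cast_sub (Finset.card_le_univ S)]
      nlinarith
    have h2 : 𝒢.d i' (W (f (x * y)) (φ (x * y).right))
        (W (f x) (φ x.right) * W (f y) (φ y.right)) ≤ ε / 4 + 4 * (3 * (ε / 40)) := by
      rw [hW.map_mul]
      refine (hW.upper _ _ _ _ (fun a => if a ∈ T then 4 else ε / 4) (fun a => ?_)
        (fun a ha => ?_)).trans ?_
      · split_ifs <;> positivity
      · by_cases haT : a ∈ T
        · simp [haT] at ha
        · simp only [haT, if_false]
          simp only [T, Finset.mem_union, Finset.mem_filter, Finset.mem_univ, true_and,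
            not_or, not_not, Finset.mem_map_equiv, Finset.mem_compl] at haT
          obtain ⟨hm, hs1, hs2⟩ := haT
          replace hs1 : φ y.right a ∈ S := hs1
          replace hs2 : φ x.right (φ y.right a) ∈ S := hs2
          refine ⟨hm, le_of_lt ?_⟩
          have key := hθact x.right (hFΓ x hx) y.left (hP y hy) _ hs1 hs2
          simp only [f]
          rw [hm, ← key, Equiv.Perm.mul_apply, SemidirectProduct.mul_left, _root_.map_mul]
          refine hχ _ (hQ1 _ _ (hP x hx)) _ (hQ2 _ _ (hFΓ x hx) _ (hP y hy)) ?_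
          rw [← _root_.map_mul]
          exact hQ1 _ _ (hP _ hxy)
      · rw [div_le_iff₀ hcA, Finset.sum_ite, Finset.sum_const, Finset.sum_const, nsmul_eq_mul,
          nsmul_eq_mul]
        have e1 : (Finset.univ.filter fun a => a ∈ T) = T := by simp
        have e2 : ((Finset.univ.filter fun a => a ∉ T).card : ℝ) ≤ Fintype.card A := by
          exact_mod_cast Finset.card_le_univ _
        rw [e1]
        nlinarith
    show 𝒢.d i' (W (f (x * y)) (φ (x * y).right)) (W (f x) (φ x.right) * W (f y) (φ y.right)) +
      𝒢.d j (ψ (x * y).right) (ψ x.right * ψ y.right) < ε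
    linarith
  · intro x hx hx1
    show min c c' / 2 < 𝒢.d l (ι (W (f x) (φ x.right), ψ x.right)) 1
    obtain ⟨h1, h2⟩ := hι' (W (f x) (φ x.right), ψ x.right)
    by_cases hxr : x.right = 1
    · have hxl : x.left ≠ 1 := fun h => hx1 (SemidirectProduct.ext h hxr)
      have h3 := hW.lower (f x)
      have h4 : c < (∑ a, 𝒢.d i (f x a) 1) / Fintype.card A := by
        rw [lt_div_iff₀ hcA]
        calc c * Fintype.card A = ∑ _a : A, c := by simp [mul_comm]
          _ < _ := Finset.sum_lt_sum_of_nonempty Finset.univ_nonempty fun a _ =>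
            hχs _ (hQ1 _ _ (hP x hx)) fun h => hxl (hθ _ (h.trans (_root_.map_one _).symm))
      rw [hxr, hφ1] at h1 ⊢
      have := min_le_left c c'
      simp only at h1
      linarith
    · have := hψs _ (hFΓ x hx) hxr
      have := min_le_right c c'
      simp only at h2
      linarith

/-! ## Families indexed by the size -/

theorem IsWreathMap.const_le {G H : Type*} [Group G] [Group H] {dG : G → G → ℝ} {dH : H → H → ℝ}
    {A : Type} [Fintype A] [Nonempty A] {W : (A → G) → Equiv.Perm A → H} (hW : IsWreathMap dG dH W)
    (hd : ∀ x y, 0 ≤ dG x y) (x y : G) : dH (W (fun _ => x) 1) (W (fun _ => y) 1) ≤ dG x y := by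
  refine (hW.upper _ _ _ _ (fun _ => dG x y) (fun _ => hd _ _)
    fun _ _ => ⟨rfl, le_rfl⟩).trans_eq ?_
  have : (Fintype.card A : ℝ) ≠ 0 := by simp
  rw [Finset.sum_const, nsmul_eq_mul, Finset.card_univ]
  field_simp

theorem IsWreathMap.le_const {G H : Type*} [Group G] [Group H] {dG : G → G → ℝ} {dH : H → H → ℝ}
    {A : Type} [Fintype A] [Nonempty A] {W : (A → G) → Equiv.Perm A → H} (hW : IsWreathMap dG dH W)
    (x : G) : dG x 1 ≤ dH (W (fun _ => x) 1) 1 := by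
  refine le_trans (le_of_eq ?_) (hW.lower fun _ => x)
  have : (Fintype.card A : ℝ) ≠ 0 := by simp
  rw [Finset.sum_const, nsmul_eq_mul, Finset.card_univ]
  field_simp

/-- A criterion for a family of groups indexed by their size to be closed under wreath products. -/
theorem isWreathClosed_of_pnat {C : ℕ+ → Type v} [grp : ∀ n, Group (C n)]
    (d : ∀ n, C n → C n → ℝ) (nonneg : ∀ n x y, 0 ≤ d n x y) (self : ∀ n x, d n x x = 0)
    (wreath : ∀ (n m : ℕ+) (A : Type) [Fintype A], (m : ℕ) = Fintype.card A * n →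
      ∃ W : (A → C n) → Equiv.Perm A → C m, IsWreathMap (d n) (d m) W ∧
        ∀ σ : Equiv.Perm A, (∀ a, σ a ≠ a) → 1 / 2 ≤ d m (W 1 σ) 1) :
    MetricFamily.IsWreathClosed ⟨ℕ+, C, grp, d⟩ where
  nonneg := nonneg
  self_eq_zero := self
  wreath := fun n A _ _ => by
    obtain ⟨W, hW, -⟩ := wreath n (⟨Fintype.card A, Fintype.card_pos⟩ * n) A rfl
    exact ⟨_, W, hW⟩
  prod := fun i j => by
    -- Constant families bring both groups to the common size `i * j` without increasing distances
    -- or decreasing distances to the identity. The two blocks indexed by `Bool` then average the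
    -- two metrics, whence the factor 1/2.
    obtain ⟨W₁, h₁, -⟩ := wreath i (i * j) (Fin j) (by simp [mul_comm])
    obtain ⟨W₂, h₂, -⟩ := wreath j (i * j) (Fin i) (by simp)
    obtain ⟨W, h, -⟩ := wreath (i * j) (2 * (i * j)) Bool (by simp)
    let g : C i × C j → Bool → C (i * j) := fun x b =>
      if b then W₁ (fun _ => x.1) 1 else W₂ (fun _ => x.2) 1
    have hi : Nonempty (Fin i) := ⟨⟨0, i.pos⟩⟩
    have hj : Nonempty (Fin j) := ⟨⟨0, j.pos⟩⟩
    refine ⟨2 * (i * j), MonoidHom.mk' (fun x => W (g x) 1) fun x y => ?_, fun x y => ?_,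
      fun x => ?_⟩
    · rw [h.map_mul]
      congr 1
      funext b
      cases b
      · exact (h₂.map_mul (fun _ => x.2) 1 (fun _ => y.2) 1).symm
      · exact (h₁.map_mul (fun _ => x.1) 1 (fun _ => y.1) 1).symm
    · refine (h.upper (g x) 1 (g y) 1 (fun b => d _ (g x b) (g y b)) (fun _ => nonneg _ _ _)
        fun _ _ => ⟨rfl, le_rfl⟩).trans ?_
      have e₁ : d _ (g x true) (g y true) ≤ d i x.1 y.1 := h₁.const_le (nonneg _) _ _
      have e₂ : d _ (g x false) (g y false) ≤ d j x.2 y.2 := h₂.const_le (nonneg _) _ _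
      have e₃ := nonneg _ x.1 y.1
      have e₄ := nonneg _ x.2 y.2
      simp only [Fintype.univ_bool, Finset.mem_singleton, Bool.true_eq_false, not_false_eq_true,
        Finset.sum_insert, Finset.sum_singleton, Fintype.card_bool, Nat.cast_ofNat]
      linarith
    · have e := h.lower (g x)
      have e₁ : d i x.1 1 ≤ d _ (g x true) 1 := h₁.le_const _
      have e₂ : d j x.2 1 ≤ d _ (g x false) 1 := h₂.le_const _
      have e₃ := nonneg _ x.1 1
      have e₄ := nonneg _ x.2 1
      simp only [Fintype.univ_bool, Finset.mem_singleton, Bool.true_eq_false, not_false_eq_true,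
        Finset.sum_insert, Finset.sum_singleton, Fintype.card_bool, Nat.cast_ofNat] at e
      constructor
      · show d i x.1 1 / 2 ≤ d _ (W (g x) 1) 1
        linarith
      · show d j x.2 1 / 2 ≤ d _ (W (g x) 1) 1
        linarith
  perm := fun n => by
    -- The regular representation with blocks of size 1: left multiplication by `σ ≠ 1` has no fixed
    -- point, so the bound for fixed-point-free permutations applies.
    obtain ⟨m, hm⟩ : ∃ m : ℕ+, (m : ℕ) = Fintype.card (Equiv.Perm (Fin n)) :=
      ⟨⟨_, Fintype.card_pos⟩, rfl⟩
    obtain ⟨W, h, hp⟩ := wreath 1 m (Equiv.Perm (Fin n)) (by simp [hm])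
    refine ⟨m, MonoidHom.mk' (fun σ => W 1 (Equiv.mulLeft σ)) fun σ τ => ?_, fun σ hσ => ?_⟩
    · rw [h.map_mul]
      congr 1
      funext
      exact (mul_one 1).symm
    · exact hp _ fun a ha => hσ (by simpa using ha)

/-! ## Symmetric groups -/

theorem permDist_eq_sum {A : Type*} [Fintype A] [DecidableEq A] (σ τ : Equiv.Perm A) :
    permDist σ τ = (∑ a, if σ a = τ a then (0 : ℝ) else 1) / Fintype.card A := by
  rw [permDist, Nat.card_eq_fintype_card, Fintype.card_subtype, ← Finset.sum_boole]
  congr 1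
  refine Finset.sum_congr rfl fun a _ => ?_
  by_cases h : σ a = τ a <;> simp [h]

theorem permDist_nonneg {A : Type*} [Fintype A] (σ τ : Equiv.Perm A) : 0 ≤ permDist σ τ := by
  unfold permDist; positivity

theorem permDist_permCongr {A B : Type*} [Fintype A] [Fintype B] (e : A ≃ B)
    (σ τ : Equiv.Perm A) : permDist (e.permCongr σ) (e.permCongr τ) = permDist σ τ := by
  classical
  rw [permDist_eq_sum, permDist_eq_sum, ← e.sum_comp, Fintype.card_congr e]
  simp

/-- The sum over `A × B` splits into fibres; where `σ` and `σ'` differ, the whole fibre is moved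
apart. The quotient of equal cardinalities keeps the formula valid for empty `B`, where it is 0. -/
theorem permDist_prodShear {A B : Type*} [Fintype A] [Fintype B] [DecidableEq A] [DecidableEq B]
    (f f' : A → Equiv.Perm B) (σ σ' : Equiv.Perm A) :
    permDist (Equiv.prodShear σ f) (Equiv.prodShear σ' f') =
      (∑ a, if σ a = σ' a then permDist (f a) (f' a) else
        (Fintype.card B : ℝ) / Fintype.card B) / Fintype.card A := by
  rw [permDist_eq_sum, Fintype.sum_prod_type, Fintype.card_prod, Nat.cast_mul,
    mul_comm (Fintype.card A : ℝ), ← div_div, Finset.sum_div]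
  congr 1
  refine Finset.sum_congr rfl fun a _ => ?_
  split_ifs with h
  · rw [permDist_eq_sum]
    simp [Equiv.prodShear, h]
  · simp [Equiv.prodShear, h]

/-- The wreath product acts imprimitively on `A × Fin n`, which has `m` points. -/
theorem symFamily_isWreathClosed : symFamily.IsWreathClosed := by
  refine isWreathClosed_of_pnat (C := fun n => Equiv.Perm (Fin n)) (fun _ => permDist)
    (fun _ => permDist_nonneg) (fun _ x => by simp [permDist]) fun n m A _ hm => ?_
  classical
  have hn : ((n : ℕ) : ℝ) / (n : ℕ) = 1 := div_self (by exact_mod_cast n.ne_zero)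
  let e : A × Fin n ≃ Fin m := Fintype.equivOfCardEq (by simp [hm])
  have hc : ∀ x : Equiv.Perm (A × Fin n), permDist (e.permCongr x) 1 = permDist x 1 := fun x => by
    rw [← permDist_permCongr e]
    congr 1
    ext; simp
  have h1 : Equiv.prodShear (1 : Equiv.Perm A) (1 : A → Equiv.Perm (Fin n)) = 1 := rfl
  refine ⟨fun f σ => e.permCongr (Equiv.prodShear σ f), ⟨?_, ?_, ?_, ?_⟩, ?_⟩
  · rw [h1]; ext; simp
  · intro f σ f' σ'
    ext x
    simp [Equiv.prodShear]
  · intro f σ f' σ' t ht0 ht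
    rw [permDist_permCongr, permDist_prodShear]
    gcongr with a
    by_cases hta : t a < 4
    · rw [if_pos (ht a hta).1]
      exact (ht a hta).2
    · split_ifs
      · refine le_trans ?_ (not_lt.1 hta)
        rw [permDist]
        refine div_le_of_le_mul₀ (by positivity) (by norm_num) ?_
        have : Nat.card {i : Fin n // f a i ≠ f' a i} ≤ Fintype.card (Fin n) := by
          rw [Nat.card_eq_fintype_card]
          exact Fintype.card_subtype_le _
        have : (Nat.card {i : Fin n // f a i ≠ f' a i} : ℝ) ≤ Fintype.card (Fin n) := by
          exact_mod_cast this
        linarith [(Nat.cast_nonneg _ : (0 : ℝ) ≤ Fintype.card (Fin n))]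
      · rw [Fintype.card_fin, hn]
        linarith
  · intro f
    rw [hc, ← h1, permDist_prodShear]
    simp
  · intro σ hσ
    rw [hc, ← h1, permDist_prodShear]
    have hA : Nonempty A := by
      rw [← Fintype.card_pos_iff]
      exact Nat.pos_of_mul_pos_right (hm ▸ m.pos)
    have hA : (Fintype.card A : ℝ) ≠ 0 := by simp
    simp only [Equiv.Perm.coe_one, id, hσ, if_false, Fintype.card_fin, hn]
    simp only [Finset.sum_const, Finset.card_univ, nsmul_eq_mul, mul_one, div_self hA]
    norm_num

/-! ## Block monomial matrices -/

section BlockMonomial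

variable {A ι R : Type*} [DecidableEq A]

/-- The block monomial matrix with the block `f a` at the position `(σ a, a)`. -/
def blockMonomial [Zero R] (f : A → Matrix ι ι R) (σ : Equiv.Perm A) : Matrix (A × ι) (A × ι) R :=
  Matrix.of fun p q => if p.1 = σ q.1 then f q.1 p.2 q.2 else 0

theorem blockMonomial_apply [Zero R] (f : A → Matrix ι ι R) (σ : Equiv.Perm A) (p q : A × ι) :
    blockMonomial f σ p q = if p.1 = σ q.1 then f q.1 p.2 q.2 else 0 := rfl

theorem blockMonomial_mul [Fintype A] [Fintype ι] [NonUnitalNonAssocSemiring R]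
    (f f' : A → Matrix ι ι R) (σ σ' : Equiv.Perm A) :
    blockMonomial f σ * blockMonomial f' σ' =
      blockMonomial (fun a => f (σ' a) * f' a) (σ * σ') := by
  ext p q
  rw [Matrix.mul_apply, Fintype.sum_prod_type, Finset.sum_eq_single (σ' q.1)]
  · simp only [blockMonomial_apply, if_true]
    by_cases h : p.1 = (σ * σ') q.1
    · have h' : p.1 = σ (σ' q.1) := h
      simp only [if_pos h, if_pos h', Matrix.mul_apply]
    · have h' : p.1 ≠ σ (σ' q.1) := h
      simp only [if_neg h, if_neg h', zero_mul, Finset.sum_const_zero]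
  · intro b _ hb
    simp [blockMonomial_apply, hb]
  · simp

theorem blockMonomial_one [DecidableEq ι] [Zero R] [One R] :
    blockMonomial (1 : A → Matrix ι ι R) 1 = 1 := by
  ext p q
  simp only [blockMonomial_apply, Pi.one_apply, Matrix.one_apply, Equiv.Perm.coe_one, id,
    Prod.ext_iff]
  split_ifs <;> simp_all

end BlockMonomial

/-! ## Unitary groups -/

/-- The groups `U(n)`, `n ≥ 1`, with the square of the normalized Hilbert-Schmidt metric. -/
noncomputable def unitarySqFamily : MetricFamily.{0, 0} where
  Idx := ℕ+
  carrier n := Matrix.unitaryGroup (Fin n) ℂ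
  group _ := inferInstance
  d _ A B := hsDist A B ^ 2

/-- Squaring only replaces `c` and `ε` by their squares or square roots. The square violates the
triangle inequality, but closure under wreath products does not ask for it. -/
theorem isApproximable_unitarySqFamily_iff {Γ : Type w} [Group Γ] :
    IsApproximable unitarySqFamily Γ ↔ IsApproximable unitaryFamily Γ := by
  have h0 : ∀ (n : ℕ+) (A B : Matrix.unitaryGroup (Fin n) ℂ), 0 ≤ hsDist A B :=
    fun n A B => Real.sqrt_nonneg _
  constructor
  · rintro ⟨c, hc, h⟩
    refine ⟨Real.sqrt c, Real.sqrt_pos.2 hc, fun F ε hε => ?_⟩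
    obtain ⟨n, φ, h1, h2, h3⟩ := h F (ε ^ 2) (by positivity)
    exact ⟨n, φ, h1, fun g hg h hh hgh => lt_of_pow_lt_pow_left₀ 2 hε.le (h2 g hg h hh hgh),
      fun g hg hg1 =>
        (Real.sqrt_lt_sqrt hc.le (h3 g hg hg1)).trans_eq (Real.sqrt_sq (h0 n _ _))⟩
  · rintro ⟨c, hc, h⟩
    refine ⟨c ^ 2, by positivity, fun F ε hε => ?_⟩
    obtain ⟨n, φ, h1, h2, h3⟩ := h F (Real.sqrt ε) (Real.sqrt_pos.2 hε)
    exact ⟨n, φ, h1, fun g hg h hh hgh => (Real.lt_sqrt (h0 n _ _)).1 (h2 g hg h hh hgh),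
      fun g hg hg1 => pow_lt_pow_left₀ (h3 g hg hg1) hc.le two_ne_zero⟩

/-- The square of the unnormalized Hilbert-Schmidt distance, summed by columns. -/
noncomputable def hsSq {ι : Type*} [Fintype ι] (M N : Matrix ι ι ℂ) : ℝ :=
  ∑ j, ∑ i, ‖M i j - N i j‖ ^ 2

theorem hsSq_reindex {ι κ : Type*} [Fintype ι] [Fintype κ] (e : ι ≃ κ) (M N : Matrix ι ι ℂ) :
    hsSq (Matrix.reindex e e M) (Matrix.reindex e e N) = hsSq M N := by
  unfold hsSq
  rw [← e.sum_comp]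
  refine Finset.sum_congr rfl fun j _ => ?_
  rw [← e.sum_comp]
  simp

theorem hsDist_sq {n : ℕ} (M N : Matrix.unitaryGroup (Fin n) ℂ) :
    hsDist M N ^ 2 = hsSq (M : Matrix (Fin n) (Fin n) ℂ) N / n := by
  rw [hsDist, Real.sq_sqrt (by positivity), Finset.sum_comm]
  rfl

theorem hsSq_blockMonomial {A ι : Type*} [Fintype A] [Fintype ι] [DecidableEq A]
    (f f' : A → Matrix ι ι ℂ) (σ σ' : Equiv.Perm A) :
    hsSq (blockMonomial f σ) (blockMonomial f' σ') =
      ∑ a, ∑ j, ∑ p, ‖blockMonomial f σ p (a, j) - blockMonomial f' σ' p (a, j)‖ ^ 2 := by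
  rw [hsSq, Fintype.sum_prod_type]

theorem sum_blockMonomial_sub_of_eq {A ι : Type*} [Fintype A] [Fintype ι] [DecidableEq A]
    (f f' : A → Matrix ι ι ℂ) (σ σ' : Equiv.Perm A) {a : A} (h : σ a = σ' a) :
    ∑ j, ∑ p, ‖blockMonomial f σ p (a, j) - blockMonomial f' σ' p (a, j)‖ ^ 2 =
      hsSq (f a) (f' a) := by
  unfold hsSq
  refine Finset.sum_congr rfl fun j _ => ?_
  rw [Fintype.sum_prod_type, Finset.sum_eq_single (σ a)]
  · simp [blockMonomial_apply, h]
  · intro b _ hb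
    have hb' : b ≠ σ' a := h ▸ hb
    simp [blockMonomial_apply, hb, hb']
  · simp

theorem sum_norm_sq_unitary {ι : Type*} [Fintype ι] [DecidableEq ι]
    (M : Matrix.unitaryGroup ι ℂ) (j : ι) : ∑ i, ‖(M : Matrix ι ι ℂ) i j‖ ^ 2 = 1 := by
  have h := congrFun (congrFun (Matrix.mem_unitaryGroup_iff'.1 M.2) j) j
  rw [Matrix.mul_apply, Matrix.one_apply_eq] at h
  have h2 : ((∑ i, ‖(M : Matrix ι ι ℂ) i j‖ ^ 2 : ℝ) : ℂ) = 1 := by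
    rw [← h]
    push_cast
    refine Finset.sum_congr rfl fun i _ => ?_
    rw [Matrix.star_apply]
    exact (RCLike.conj_mul _).symm
  exact_mod_cast h2

/-- All columns are unit vectors, and `‖x - y‖² ≤ 2‖x‖² + 2‖y‖²`. This is the source of the
threshold 4 in `IsWreathMap.upper`. -/
theorem sum_blockMonomial_sub_le {A ι : Type*} [Fintype A] [Fintype ι] [DecidableEq A]
    [DecidableEq ι] (f f' : A → Matrix.unitaryGroup ι ℂ) (σ σ' : Equiv.Perm A) (a : A) :
    ∑ j, ∑ p, ‖blockMonomial (fun a => (f a : Matrix ι ι ℂ)) σ p (a, j) -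
      blockMonomial (fun a => (f' a : Matrix ι ι ℂ)) σ' p (a, j)‖ ^ 2 ≤ 4 * Fintype.card ι := by
  have key : ∀ (f : A → Matrix.unitaryGroup ι ℂ) (σ : Equiv.Perm A) (j : ι),
      ∑ p, ‖blockMonomial (fun a => (f a : Matrix ι ι ℂ)) σ p (a, j)‖ ^ 2 = 1 := fun f σ j => by
    rw [← sum_norm_sq_unitary (f a) j, Fintype.sum_prod_type, Finset.sum_eq_single (σ a)]
    · simp [blockMonomial_apply]
    · intro b _ hb
      simp [blockMonomial_apply, hb]
    · simp
  calc _ ≤ ∑ _j : ι, (4 : ℝ) := Finset.sum_le_sum fun j _ => ?_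
    _ = _ := by simp [mul_comm]
  calc _ ≤ ∑ p, (2 * ‖blockMonomial (fun a => (f a : Matrix ι ι ℂ)) σ p (a, j)‖ ^ 2 +
        2 * ‖blockMonomial (fun a => (f' a : Matrix ι ι ℂ)) σ' p (a, j)‖ ^ 2) :=
      Finset.sum_le_sum fun p _ => ?_
    _ = 4 := by
      rw [Finset.sum_add_distrib, ← Finset.mul_sum, ← Finset.mul_sum, key, key]; norm_num
  set x := blockMonomial (fun a => (f a : Matrix ι ι ℂ)) σ p (a, j)
  set y := blockMonomial (fun a => (f' a : Matrix ι ι ℂ)) σ' p (a, j)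
  nlinarith [norm_sub_le x y, norm_nonneg (x - y), norm_nonneg x, norm_nonneg y,
    sq_nonneg (‖x‖ - ‖y‖)]

theorem blockMonomial_mem_unitaryGroup {A ι : Type*} [Fintype A] [Fintype ι] [DecidableEq A]
    [DecidableEq ι] (f : A → Matrix.unitaryGroup ι ℂ) (σ : Equiv.Perm A) :
    blockMonomial (fun a => (f a : Matrix ι ι ℂ)) σ ∈ Matrix.unitaryGroup (A × ι) ℂ := by
  rw [Matrix.mem_unitaryGroup_iff']
  have h : star (blockMonomial (fun a => (f a : Matrix ι ι ℂ)) σ) =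
      blockMonomial (fun a => star (f (σ⁻¹ a) : Matrix ι ι ℂ)) σ⁻¹ := by
    ext p q
    rw [Matrix.star_apply, blockMonomial_apply, blockMonomial_apply]
    by_cases h : q.1 = σ p.1
    · simp [h]
    · have h' : p.1 ≠ σ⁻¹ q.1 := fun h2 => h (by simp [h2])
      rw [if_neg h, if_neg h', star_zero]
  rw [h, blockMonomial_mul, inv_mul_cancel, ← blockMonomial_one]
  congr 1
  funext a
  have : σ⁻¹ (σ a) = a := σ.symm_apply_apply a
  rw [this]
  exact Matrix.mem_unitaryGroup_iff'.1 (f a).2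

theorem reindex_mem_unitaryGroup {ι κ : Type*} [Fintype ι] [Fintype κ] [DecidableEq ι]
    [DecidableEq κ] (e : ι ≃ κ) {M : Matrix ι ι ℂ} (hM : M ∈ Matrix.unitaryGroup ι ℂ) :
    Matrix.reindex e e M ∈ Matrix.unitaryGroup κ ℂ := by
  rw [Matrix.mem_unitaryGroup_iff'] at hM ⊢
  rw [Matrix.star_eq_conjTranspose, Matrix.conjTranspose_reindex, Matrix.reindex_apply,
    Matrix.reindex_apply, Matrix.submatrix_mul_equiv, ← Matrix.star_eq_conjTranspose, hM,
    Matrix.submatrix_one_equiv]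

theorem unitarySqFamily_isWreathClosed : unitarySqFamily.IsWreathClosed := by
  refine isWreathClosed_of_pnat (C := fun n => Matrix.unitaryGroup (Fin n) ℂ)
    (fun _ M N => hsDist M N ^ 2) (fun _ _ _ => sq_nonneg _) (fun _ x => by simp [hsDist])
    fun n m A _ hm => ?_
  classical
  have hn : (0 : ℝ) < (n : ℕ) := by exact_mod_cast n.pos
  have hA : Nonempty A := by
    rw [← Fintype.card_pos_iff]
    exact Nat.pos_of_mul_pos_right (hm ▸ m.pos)
  have hA : (0 : ℝ) < Fintype.card A := by exact_mod_cast Fintype.card_pos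
  have hm' : ((m : ℕ) : ℝ) = Fintype.card A * (n : ℕ) := by rw [hm]; push_cast; rfl
  let e : A × Fin n ≃ Fin m := Fintype.equivOfCardEq (by simp [hm])
  let W : (A → Matrix.unitaryGroup (Fin n) ℂ) → Equiv.Perm A → Matrix.unitaryGroup (Fin m) ℂ :=
    fun f σ => ⟨_, reindex_mem_unitaryGroup e (blockMonomial_mem_unitaryGroup f σ)⟩
  have h1 : W 1 1 = 1 := Subtype.ext <| by
    change Matrix.reindex e e (blockMonomial 1 1) = 1
    rw [blockMonomial_one, Matrix.reindex_apply, Matrix.submatrix_one_equiv]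
  have hd : ∀ f σ f' σ', hsDist (W f σ) (W f' σ') ^ 2 =
      (∑ a, (∑ j, ∑ p, ‖blockMonomial (fun a => (f a : Matrix (Fin n) (Fin n) ℂ)) σ p (a, j) -
        blockMonomial (fun a => (f' a : Matrix (Fin n) (Fin n) ℂ)) σ' p (a, j)‖ ^ 2) / (n : ℕ)) /
        Fintype.card A := fun f σ f' σ' => by
    rw [hsDist_sq, hsSq_reindex, hsSq_blockMonomial, hm', mul_comm, ← div_div, Finset.sum_div]
  refine ⟨W, ⟨h1, ?_, ?_, ?_⟩, ?_⟩
  · intro f σ f' σ'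
    refine Subtype.ext ?_
    change Matrix.reindex e e (blockMonomial _ _) * Matrix.reindex e e (blockMonomial _ _) =
      Matrix.reindex e e (blockMonomial _ _)
    rw [Matrix.reindex_apply, Matrix.reindex_apply, Matrix.submatrix_mul_equiv, blockMonomial_mul]
    rfl
  · intro f σ f' σ' t ht0 ht
    rw [hd]
    gcongr with a
    by_cases hta : t a < 4
    · have := (ht a hta).2
      rwa [hsDist_sq, ← sum_blockMonomial_sub_of_eq (fun a => (f a : Matrix (Fin n) (Fin n) ℂ))
        (fun a => (f' a : Matrix (Fin n) (Fin n) ℂ)) σ σ' (ht a hta).1] at this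
    · rw [div_le_iff₀ hn]
      refine (sum_blockMonomial_sub_le f f' σ σ' a).trans ?_
      rw [Fintype.card_fin]
      gcongr
      exact not_lt.1 hta
  · intro f
    conv_rhs => rw [← h1, hd]
    gcongr with a
    rw [hsDist_sq, sum_blockMonomial_sub_of_eq _ _ _ _ rfl]
    rfl
  · intro σ hσ
    conv_rhs => rw [← h1, hd]
    rw [le_div_iff₀ hA]
    calc (1 / 2 * Fintype.card A : ℝ) ≤ ∑ _a : A, (1 : ℝ) := by simp; linarith
      _ ≤ _ := Finset.sum_le_sum fun a _ => ?_
    rw [le_div_iff₀ hn]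
    calc (1 * (n : ℕ) : ℝ) = ∑ _j : Fin n, (1 : ℝ) := by simp
      _ ≤ _ := Finset.sum_le_sum fun j _ => ?_
    -- In the column `(a, j)` the entry in row `(σ a, j)` is 1 for the permutation and 0 for the
    -- identity, as `σ a ≠ a`.
    refine le_trans (le_of_eq ?_) (Finset.single_le_sum (fun p _ => by positivity)
      (Finset.mem_univ ((σ a, j) : A × Fin n)))
    simp [blockMonomial_apply, hσ a]

/-! ## General linear groups -/

section Rank

variable {K : Type*} [Field K]

theorem Matrix.cast_rank_eq_rank_mulVecLin {m n : Type} [Fintype m] [Fintype n]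
    (M : Matrix m n K) : (M.rank : Cardinal) = LinearMap.rank M.mulVecLin :=
  Module.finrank_eq_rank _ _

theorem Matrix.rank_le_sum_rank_blocks {p A ι : Type} [Fintype p] [Fintype A] [Fintype ι]
    (D : Matrix p (A × ι) K) : D.rank ≤ ∑ a, (D.submatrix id (Prod.mk a)).rank := by
  have h : D.mulVecLin = ∑ a, (D.submatrix id (Prod.mk a)).mulVecLin ∘ₗ
      LinearMap.funLeft K K (Prod.mk a) := by
    ext1 v
    funext x
    simp [Matrix.mulVec, dotProduct, Fintype.sum_prod_type, LinearMap.funLeft_apply]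
  have h2 : (D.rank : Cardinal) ≤ ((∑ a, (D.submatrix id (Prod.mk a)).rank : ℕ) : Cardinal) := by
    rw [Matrix.cast_rank_eq_rank_mulVecLin, h, Nat.cast_sum]
    refine (LinearMap.rank_finsetSum_le _ _).trans (Finset.sum_le_sum fun a _ => ?_)
    rw [Matrix.cast_rank_eq_rank_mulVecLin]
    exact LinearMap.rank_comp_le_left _ _
  exact_mod_cast h2

/-- Rank is subadditive over column blocks. If `σ a = σ' a`, the block column is supported in one
block row, so it factors through `f a - f' a`; otherwise only its width bounds its rank. -/
theorem rank_blockMonomial_sub_le {A ι : Type} [Fintype A] [Fintype ι] [DecidableEq A]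
    (f f' : A → Matrix ι ι K) (σ σ' : Equiv.Perm A) :
    (blockMonomial f σ - blockMonomial f' σ').rank ≤
      ∑ a, if σ a = σ' a then (f a - f' a).rank else Fintype.card ι := by
  classical
  refine (Matrix.rank_le_sum_rank_blocks _).trans (Finset.sum_le_sum fun a _ => ?_)
  split_ifs with h
  · have : (blockMonomial f σ - blockMonomial f' σ').submatrix id (Prod.mk a) =
        (Matrix.of fun (p : A × ι) i => if p = (σ a, i) then (1 : K) else 0) * (f a - f' a) := by
      ext p j
      obtain ⟨b, i⟩ := p
      by_cases hb : b = σ a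
      · subst hb
        simp [Matrix.mul_apply, blockMonomial_apply, h]
      · have hb' : b ≠ σ' a := h ▸ hb
        simp [Matrix.mul_apply, blockMonomial_apply, hb, hb']
    rw [this]
    exact Matrix.rank_mul_le_right _ _
  · exact Matrix.rank_le_card_width _

theorem Matrix.exists_mul_mul_eq_diagonal {ι : Type} [Fintype ι] [DecidableEq ι]
    (M : Matrix ι ι K) : ∃ (V U : Matrix ι ι K) (w : ι → K),
      V * M * U = Matrix.diagonal w ∧ (Matrix.diagonal w).rank = M.rank := by
  obtain ⟨V, U, e, hV, hU, h⟩ := M.exists_rank_normal_form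
  have h' : V * M * U = Matrix.diagonal fun i => Sum.elim (fun _ => (1 : K)) (fun _ => 0) (e i) := by
    rw [h, ← Matrix.diagonal_one, ← Matrix.diagonal_zero, Matrix.fromBlocks_diagonal,
      Matrix.submatrix_diagonal_equiv]
    rfl
  refine ⟨V, U, _, h', ?_⟩
  rw [← h', Matrix.rank_mul_eq_left_of_isUnit_det _ _ ((Matrix.isUnit_iff_isUnit_det _).1 hU),
    Matrix.rank_mul_eq_right_of_isUnit_det _ _ ((Matrix.isUnit_iff_isUnit_det _).1 hV)]

/-- Multiplying by block diagonal matrices diagonalises all the blocks at once, and the rank of a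
diagonal matrix counts its nonzero entries. Multiplication cannot raise the rank, which gives the
inequality. -/
theorem sum_rank_le_rank_blockMonomial {A ι : Type} [Fintype A] [Fintype ι] [DecidableEq A]
    [DecidableEq ι] (f : A → Matrix ι ι K) : ∑ a, (f a).rank ≤ (blockMonomial f 1).rank := by
  classical
  choose V U w h hr using fun a => (f a).exists_mul_mul_eq_diagonal
  have h' : blockMonomial V 1 * blockMonomial f 1 * blockMonomial U 1 =
      Matrix.diagonal fun p : A × ι => w p.1 p.2 := by
    rw [blockMonomial_mul, blockMonomial_mul]
    ext ⟨a, i⟩ ⟨b, j⟩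
    simp only [blockMonomial_apply, Equiv.Perm.coe_one, id, mul_one, h, Matrix.diagonal_apply,
      Prod.ext_iff]
    by_cases hab : a = b
    · subst hab; simp
    · simp [hab]
  calc ∑ a, (f a).rank = (Matrix.diagonal fun p : A × ι => w p.1 p.2).rank := by
        rw [Matrix.rank_diagonal, Fintype.card_subtype, Finset.card_filter, Fintype.sum_prod_type]
        refine Finset.sum_congr rfl fun a _ => ?_
        rw [← hr, Matrix.rank_diagonal, Fintype.card_subtype, Finset.card_filter]
    _ ≤ _ := by
        rw [← h']
        exact (Matrix.rank_mul_le_left _ _).trans (Matrix.rank_mul_le_right _ _)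

/-- The quotient is the set of cycles of `τ`. A representative and its image under `τ` are two
distinct points of the same cycle, so two copies of the quotient inject into `B`. -/
theorem two_mul_card_quot_le {B : Type} [Fintype B] (τ : Equiv.Perm B) (hτ : ∀ b, τ b ≠ b) :
    2 * Nat.card (Quot fun b c => τ b = c) ≤ Fintype.card B := by
  classical
  let j : Bool × (Quot fun b c => τ b = c) → B := fun x => if x.1 then x.2.out else τ x.2.out
  have hj : ∀ x, Quot.mk _ (j x) = x.2 := by
    rintro ⟨b, q⟩
    cases b
    · exact (Quot.sound (r := fun b c => τ b = c) rfl).symm.trans (Quot.out_eq q)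
    · exact Quot.out_eq q
  have hinj : Function.Injective j := by
    rintro ⟨b, q⟩ ⟨b', q'⟩ h
    have : q = q' := (hj (b, q)).symm.trans ((congrArg _ h).trans (hj (b', q')))
    subst this
    cases b <;> cases b'
    · rfl
    · exact absurd h (hτ _)
    · exact absurd h.symm (hτ _)
    · rfl
  have := Nat.card_le_card_of_injective j hinj
  rwa [Nat.card_prod, Nat.card_eq_fintype_card (α := Bool), Nat.card_eq_fintype_card (α := B),
    Fintype.card_bool] at this

/-- A permutation matrix without fixed points is far from the identity in rank. -/
theorem card_le_two_mul_rank {B : Type} [Fintype B] [DecidableEq B] (τ : Equiv.Perm B)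
    (hτ : ∀ b, τ b ≠ b) (M : Matrix B B K)
    (hM : ∀ p q, M p q = (if p = τ q then 1 else 0) - if p = q then 1 else 0) :
    Fintype.card B ≤ 2 * M.rank := by
  classical
  have : Fintype (Quot fun b c => τ b = c) := Fintype.ofFinite _
  have h1 := LinearMap.finrank_range_add_finrank_ker M.mulVecLin
  -- Kernel vectors are the `τ`-invariant functions, that is, the functions on the set of cycles.
  -- There are at most half as many cycles as points.
  have h2 : LinearMap.ker M.mulVecLin ≤
      LinearMap.range (LinearMap.funLeft K K (Quot.mk fun b c => τ b = c)) := by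
    intro v hv
    have hv' : ∀ q, v (τ q) = v q := fun q => by
      have := congrFun (LinearMap.mem_ker.1 hv) (τ q)
      simp only [Matrix.mulVecLin_apply, Matrix.mulVec, dotProduct, hM, sub_mul, ite_mul, one_mul,
        zero_mul, Finset.sum_sub_distrib, EmbeddingLike.apply_eq_iff_eq, Finset.sum_ite_eq,
        Finset.mem_univ, if_true, Pi.zero_apply] at this
      exact (sub_eq_zero.1 this).symm
    exact ⟨Quot.lift v fun b c hbc => by rw [← hbc, hv'], rfl⟩
  have h3 := (Submodule.finrank_mono h2).trans (LinearMap.finrank_range_le _)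
  rw [Module.finrank_fintype_fun_eq_card] at h1 h3
  have h4 := two_mul_card_quot_le τ hτ
  rw [Nat.card_eq_fintype_card] at h4
  change M.rank + _ = _ at h1
  omega

theorem glFamily_isWreathClosed (K : Type k) [Field K] : (glFamily K).IsWreathClosed := by
  refine isWreathClosed_of_pnat (C := fun n => GL (Fin n) K) (fun _ => rankDist)
    (fun _ _ _ => by unfold rankDist; positivity) (fun _ x => by simp [rankDist])
    fun n m A _ hm => ?_
  classical
  have hn : (0 : ℝ) < (n : ℕ) := by exact_mod_cast n.pos
  have hA : Nonempty A := by
    rw [← Fintype.card_pos_iff]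
    exact Nat.pos_of_mul_pos_right (hm ▸ m.pos)
  have hA : (0 : ℝ) < Fintype.card A := by exact_mod_cast Fintype.card_pos
  have hm' : ((m : ℕ) : ℝ) = (n : ℕ) * Fintype.card A := by rw [hm]; push_cast; ring
  let e : A × Fin n ≃ Fin m := Fintype.equivOfCardEq (by simp [hm])
  let r := Matrix.reindexAlgEquiv K K e
  let V : (A → GL (Fin n) K) → Equiv.Perm A → Matrix (A × Fin n) (A × Fin n) K := fun f σ =>
    blockMonomial (fun a => (f a : Matrix (Fin n) (Fin n) K)) σ
  have hV : ∀ f σ f' σ', V f σ * V f' σ' = V (fun a => f (σ' a) * f' a) (σ * σ') :=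
    fun f σ f' σ' => blockMonomial_mul _ _ _ _
  have hV1 : V 1 1 = 1 := blockMonomial_one
  let W : (A → GL (Fin n) K) → Equiv.Perm A → GL (Fin m) K := fun f σ =>
    { val := r (V f σ)
      inv := r (V (fun a => (f (σ⁻¹ a))⁻¹) σ⁻¹)
      val_inv := by
        rw [← _root_.map_mul, hV, ← _root_.map_one r, ← hV1, mul_inv_cancel]
        congr 2
        funext a
        exact mul_inv_cancel _
      inv_val := by
        rw [← _root_.map_mul, hV, ← _root_.map_one r, ← hV1, inv_mul_cancel]
        congr 2
        funext a
        have : σ⁻¹ (σ a) = a := σ.symm_apply_apply a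
        rw [this]
        exact inv_mul_cancel _ }
  have hd : ∀ f σ f' σ', rankDist (W f σ) (W f' σ') =
      ((V f σ - V f' σ').rank : ℝ) / (n : ℕ) / Fintype.card A := fun f σ f' σ' => by
    rw [rankDist, div_div, hm']
    congr 2
    change (r (V f σ) - r (V f' σ')).rank = _
    rw [← map_sub]
    exact Matrix.rank_reindex _ _ _
  have h1 : W 1 1 = 1 := Units.ext ((congrArg r hV1).trans (_root_.map_one r))
  refine ⟨W, ⟨h1, ?_, ?_, ?_⟩, ?_⟩
  · intro f σ f' σ'
    refine Units.ext ?_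
    change r (V f σ) * r (V f' σ') = r (V _ _)
    rw [← _root_.map_mul, hV]
  · intro f σ f' σ' t ht0 ht
    rw [hd]
    gcongr
    rw [div_le_iff₀ hn, Finset.sum_mul]
    have h2 : ((V f σ - V f' σ').rank : ℝ) ≤ _ :=
      Nat.cast_le.2 (rank_blockMonomial_sub_le _ _ σ σ')
    refine h2.trans ?_
    rw [Nat.cast_sum]
    refine Finset.sum_le_sum fun a _ => ?_
    by_cases hta : t a < 4
    · have := (ht a hta).2
      rw [if_pos (ht a hta).1]
      rwa [rankDist, div_le_iff₀ hn] at this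
    · split_ifs
      · have h3 : (((f a : Matrix (Fin n) (Fin n) K) - (f' a : Matrix (Fin n) (Fin n) K)).rank : ℝ) ≤
            (n : ℕ) := Nat.cast_le.2 (Matrix.rank_le_width _)
        nlinarith
      · rw [Fintype.card_fin]
        nlinarith
  · intro f
    conv_rhs => rw [← h1, hd]
    gcongr
    rw [le_div_iff₀ hn, Finset.sum_mul]
    have h2 : V f 1 - V 1 1 = blockMonomial (fun a => (f a : Matrix (Fin n) (Fin n) K) - 1) 1 := by
      ext p q
      simp only [V, Matrix.sub_apply, blockMonomial_apply]
      split_ifs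
      · rfl
      · simp
    rw [h2]
    refine le_trans (le_of_eq ?_) (Nat.cast_le.2 (sum_rank_le_rank_blockMonomial _))
    rw [Nat.cast_sum]
    refine Finset.sum_congr rfl fun a _ => ?_
    rw [rankDist]
    field_simp
    rfl
  · intro σ hσ
    conv_rhs => rw [← h1, hd]
    rw [le_div_iff₀ hA, le_div_iff₀ hn]
    -- With identity blocks, `V 1 σ` is the permutation matrix of `σ × id` on `A × Fin n`, which is
    -- fixed-point-free because `σ` is.
    have h2 := card_le_two_mul_rank (Equiv.prodShear σ fun _ => (1 : Equiv.Perm (Fin n)))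
      (fun p h => hσ p.1 (congrArg Prod.fst h)) (V 1 σ - V 1 1) fun p q => ?_
    · rw [Fintype.card_prod, Fintype.card_fin] at h2
      have h3 : ((Fintype.card A * n : ℕ) : ℝ) ≤ ((2 * (V 1 σ - V 1 1).rank : ℕ) : ℝ) :=
        Nat.cast_le.2 h2
      push_cast at h3
      linarith
    · rw [hV1, Matrix.sub_apply, Matrix.one_apply]
      congr 1
      obtain ⟨a, i⟩ := p
      obtain ⟨b, j⟩ := q
      simp only [V, blockMonomial_apply, Equiv.prodShear, Equiv.coe_fn_mk, Prod.mk.injEq,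
        Equiv.Perm.coe_one, id, Pi.one_apply, Units.val_one, Matrix.one_apply]
      split_ifs <;> simp_all

end Rank

/-! ## Finite groups with bi-invariant metrics -/

/-- The permutational wreath product `G ≀ Sym(A)`. -/
@[ext]
structure PermWreath (A G : Type*) where
  /-- the coordinates -/
  coord : A → G
  /-- the permutation -/
  perm : Equiv.Perm A

namespace PermWreath

variable {A G : Type*} [Group G]

instance : Mul (PermWreath A G) :=
  ⟨fun x y => ⟨fun a => x.coord (y.perm a) * y.coord a, x.perm * y.perm⟩⟩

instance : One (PermWreath A G) := ⟨⟨1, 1⟩⟩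

instance : Inv (PermWreath A G) := ⟨fun x => ⟨fun a => (x.coord (x.perm⁻¹ a))⁻¹, x.perm⁻¹⟩⟩

theorem mul_def (x y : PermWreath A G) :
    x * y = ⟨fun a => x.coord (y.perm a) * y.coord a, x.perm * y.perm⟩ := rfl

theorem one_def : (1 : PermWreath A G) = ⟨1, 1⟩ := rfl

theorem inv_def (x : PermWreath A G) :
    x⁻¹ = ⟨fun a => (x.coord (x.perm⁻¹ a))⁻¹, x.perm⁻¹⟩ := rfl

instance : Group (PermWreath A G) :=
  Group.ofLeftAxioms
    (fun x y z => by simp [mul_def, mul_assoc])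
    (fun x => by simp [mul_def, one_def])
    (fun x => by
      simp only [mul_def, inv_def, one_def, inv_mul_cancel, PermWreath.mk.injEq, and_true]
      funext a
      have : x.perm⁻¹ (x.perm a) = a := x.perm.symm_apply_apply a
      rw [this]
      exact inv_mul_cancel _)

instance [Finite A] [Finite G] : Finite (PermWreath A G) :=
  Finite.of_injective (fun x : PermWreath A G => (x.coord, x.perm)) fun x y h => by
    simpa [PermWreath.ext_iff] using h

end PermWreath

namespace FiniteMetricGroup

attribute [instance] FiniteMetricGroup.group FiniteMetricGroup.finite

variable (H : FiniteMetricGroup)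

theorem self_eq_zero (x : H.carrier) : H.d x x = 0 := (H.eq_iff x x).2 rfl

theorem nonneg (x y : H.carrier) : 0 ≤ H.d x y := by
  have h1 := H.triangle x y x
  rw [H.self_eq_zero, H.symm y x] at h1
  linarith

open Classical in
/-- The contribution of a point to the metric of the wreath product. -/
noncomputable def wreathTerm {A : Type} (x y : PermWreath A H.carrier) (a : A) : ℝ :=
  if x.perm a = y.perm a then H.d (x.coord a) (y.coord a) else 1

variable {A : Type}

theorem wreathTerm_nonneg (x y : PermWreath A H.carrier) (a : A) : 0 ≤ H.wreathTerm x y a := by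
  unfold wreathTerm
  split_ifs
  · exact H.nonneg _ _
  · exact zero_le_one

theorem wreathTerm_le_one (x y : PermWreath A H.carrier) (a : A) : H.wreathTerm x y a ≤ 1 := by
  unfold wreathTerm
  split_ifs
  · exact H.le_one _ _
  · exact le_rfl

theorem wreathTerm_symm (x y : PermWreath A H.carrier) (a : A) :
    H.wreathTerm x y a = H.wreathTerm y x a := by
  by_cases h : x.perm a = y.perm a
  · rw [wreathTerm, wreathTerm, if_pos h, if_pos h.symm, H.symm]
  · rw [wreathTerm, wreathTerm, if_neg h, if_neg (Ne.symm h)]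

/-- If the permutations disagree at `a` on the right-hand side, one of the terms there is 1, which
bounds every term because the metric has diameter one. -/
theorem wreathTerm_triangle (x y z : PermWreath A H.carrier) (a : A) :
    H.wreathTerm x z a ≤ H.wreathTerm x y a + H.wreathTerm y z a := by
  by_cases h : x.perm a = y.perm a
  · by_cases h' : y.perm a = z.perm a
    · simp only [wreathTerm, h, h', if_true]
      exact H.triangle _ _ _
    · have : H.wreathTerm y z a = 1 := if_neg h'
      linarith [H.wreathTerm_le_one x z a, H.wreathTerm_nonneg x y a]
  · have : H.wreathTerm x y a = 1 := if_neg h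
    linarith [H.wreathTerm_le_one x z a, H.wreathTerm_nonneg y z a]

theorem wreathTerm_mul_left (z x y : PermWreath A H.carrier) (a : A) :
    H.wreathTerm (z * x) (z * y) a = H.wreathTerm x y a := by
  unfold wreathTerm
  by_cases h : x.perm a = y.perm a
  · simp [PermWreath.mul_def, h, H.mul_left]
  · simp [PermWreath.mul_def, h]

/-- Right translation only relabels the points by `z.perm`, so the average over `A` is right
invariant. -/
theorem wreathTerm_mul_right (z x y : PermWreath A H.carrier) (a : A) :
    H.wreathTerm (x * z) (y * z) a = H.wreathTerm x y (z.perm a) := by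
  by_cases h : x.perm (z.perm a) = y.perm (z.perm a)
  · have h' : (x * z).perm a = (y * z).perm a := h
    rw [wreathTerm, wreathTerm, if_pos h, if_pos h']
    exact H.mul_right _ _ _
  · have h' : (x * z).perm a ≠ (y * z).perm a := h
    rw [wreathTerm, wreathTerm, if_neg h, if_neg h']

theorem wreathTerm_eq_zero_iff (x y : PermWreath A H.carrier) (a : A) :
    H.wreathTerm x y a = 0 ↔ x.perm a = y.perm a ∧ x.coord a = y.coord a := by
  unfold wreathTerm
  split_ifs with h <;> simp [h, H.eq_iff]

/-- The wreath product of a finite metric group with a finite symmetric group. -/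
noncomputable def wreath (A : Type) [Fintype A] [Nonempty A] : FiniteMetricGroup where
  carrier := PermWreath A H.carrier
  d x y := (∑ a, H.wreathTerm x y a) / Fintype.card A
  eq_iff x y := by
    rw [div_eq_zero_iff, or_iff_left (by simp),
      Finset.sum_eq_zero_iff_of_nonneg fun a _ => H.wreathTerm_nonneg x y a, PermWreath.ext_iff]
    simp only [Finset.mem_univ, true_implies, wreathTerm_eq_zero_iff, forall_and]
    rw [and_comm, funext_iff, Equiv.ext_iff]
  symm x y := by simp_rw [H.wreathTerm_symm x y]
  triangle x y z := by
    rw [← add_div, ← Finset.sum_add_distrib]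
    gcongr
    exact H.wreathTerm_triangle x y z _
  mul_left z x y := by simp_rw [H.wreathTerm_mul_left]
  mul_right z x y := by
    simp_rw [H.wreathTerm_mul_right]
    rw [Equiv.sum_comp z.perm (H.wreathTerm x y)]
  le_one x y := by
    refine div_le_one_of_le₀ ?_ (by positivity)
    calc _ ≤ ∑ _a : A, (1 : ℝ) := Finset.sum_le_sum fun a _ => H.wreathTerm_le_one x y a
      _ = _ := by simp
  exists_eq_one := by
    obtain ⟨x, y, h⟩ := H.exists_eq_one
    refine ⟨⟨fun _ => x, 1⟩, ⟨fun _ => y, 1⟩, ?_⟩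
    simp [wreathTerm, h]

theorem isWreathMap_mk (A : Type) [Fintype A] [Nonempty A] :
    IsWreathMap (H := (H.wreath A).carrier) H.d (H.wreath A).d
      (PermWreath.mk : (A → H.carrier) → Equiv.Perm A → PermWreath A H.carrier) where
  map_one := rfl
  map_mul _ _ _ _ := rfl
  upper f σ f' σ' t ht0 ht := by
    change (∑ a, H.wreathTerm ⟨f, σ⟩ ⟨f', σ'⟩ a) / (Fintype.card A : ℝ) ≤ _
    gcongr with a
    by_cases hta : t a < 4
    · rw [wreathTerm, if_pos (ht a hta).1]
      exact (ht a hta).2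
    · exact (H.wreathTerm_le_one _ _ _).trans (by linarith)
  lower f := by
    change _ ≤ (∑ a, H.wreathTerm ⟨f, 1⟩ ⟨1, 1⟩ a) / (Fintype.card A : ℝ)
    gcongr with a
    rw [wreathTerm, if_pos rfl]
    exact le_rfl

/-- The product of two finite metric groups, with the maximum metric. -/
noncomputable def prod (H H' : FiniteMetricGroup) : FiniteMetricGroup where
  carrier := H.carrier × H'.carrier
  d x y := max (H.d x.1 y.1) (H'.d x.2 y.2)
  eq_iff x y := by
    rw [Prod.ext_iff, ← H.eq_iff, ← H'.eq_iff]
    have h := H.nonneg x.1 y.1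
    have h' := H'.nonneg x.2 y.2
    constructor
    · intro h0
      exact ⟨le_antisymm (h0 ▸ le_max_left _ _) h, le_antisymm (h0 ▸ le_max_right _ _) h'⟩
    · rintro ⟨h1, h2⟩
      rw [h1, h2, max_self]
  symm x y := by rw [H.symm, H'.symm]
  triangle x y z := max_le
    ((H.triangle _ _ _).trans (add_le_add (le_max_left _ _) (le_max_left _ _)))
    ((H'.triangle _ _ _).trans (add_le_add (le_max_right _ _) (le_max_right _ _)))
  mul_left z x y := by simp [H.mul_left, H'.mul_left]
  mul_right z x y := by simp [H.mul_right, H'.mul_right]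
  le_one x y := max_le (H.le_one _ _) (H'.le_one _ _)
  exists_eq_one := by
    obtain ⟨x, y, h⟩ := H.exists_eq_one
    refine ⟨(x, 1), (y, 1), ?_⟩
    simp [h, H'.self_eq_zero]

open Classical in
/-- A non-trivial finite group with the discrete metric. -/
noncomputable def discrete (G : Type) [Group G] [Finite G] [Nontrivial G] : FiniteMetricGroup where
  carrier := G
  d x y := if x = y then 0 else 1
  eq_iff x y := by simp
  symm x y := by simp [eq_comm]
  triangle x y z := by
    by_cases h : x = y
    · simp [h]
    · by_cases h' : y = z
      · simp [h']
      · simp only [h, h', if_false]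
        split_ifs <;> norm_num
  mul_left z x y := by simp
  mul_right z x y := by simp
  le_one x y := by split_ifs <;> norm_num
  exists_eq_one := by
    obtain ⟨x, y, h⟩ := exists_pair_ne G
    exact ⟨x, y, if_neg h⟩

end FiniteMetricGroup

theorem finiteFamily_isWreathClosed : finiteFamily.IsWreathClosed where
  nonneg H := FiniteMetricGroup.nonneg H
  self_eq_zero H := FiniteMetricGroup.self_eq_zero H
  wreath := by
    intro H A _ _
    exact ⟨FiniteMetricGroup.wreath H A, _, FiniteMetricGroup.isWreathMap_mk H A⟩
  prod := by
    intro H H'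
    refine ⟨FiniteMetricGroup.prod H H', MonoidHom.id (FiniteMetricGroup.prod H H').carrier,
      fun x y => ?_, fun x => ⟨?_, ?_⟩⟩
    · exact max_le_add_of_nonneg (FiniteMetricGroup.nonneg H _ _) (FiniteMetricGroup.nonneg H' _ _)
    · exact (half_le_self (FiniteMetricGroup.nonneg H _ _)).trans (le_max_left _ _)
    · exact (half_le_self (FiniteMetricGroup.nonneg H' _ _)).trans (le_max_right _ _)
  perm n := by
    -- The factor `Equiv.Perm Bool` guarantees a non-trivial group, hence diameter one, also for `n
    -- ≤ 1`.
    refine ⟨FiniteMetricGroup.discrete (Equiv.Perm (Fin n) × Equiv.Perm Bool),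
      MonoidHom.inl (Equiv.Perm (Fin n)) (Equiv.Perm Bool), fun σ hσ => ?_⟩
    refine le_of_le_of_eq (by norm_num : (1 / 2 : ℝ) ≤ 1) (if_neg fun h => hσ ?_).symm
    exact congrArg Prod.fst h

/-! ## The four classes -/

theorem GroupClass.Mem.semidirectProduct {𝒞 : GroupClass.{k}} {N : Type*} {Γ : Type*}
    [Group N] [Group Γ] (act : Γ →* MulAut N) (hN : 𝒞.Mem N) (hΓ : 𝒞.Mem Γ)
    (hact : IsSoficAutAction act) : 𝒞.Mem (N ⋊[act] Γ) := by
  cases 𝒞 with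
  | sofic => exact IsApproximable.semidirectProduct symFamily_isWreathClosed act hN hΓ hact
  | linearSofic K =>
    exact IsApproximable.semidirectProduct (glFamily_isWreathClosed K) act hN hΓ hact
  | hyperlinear =>
    exact isApproximable_unitarySqFamily_iff.1 <| IsApproximable.semidirectProduct
      unitarySqFamily_isWreathClosed act (isApproximable_unitarySqFamily_iff.2 hN)
      (isApproximable_unitarySqFamily_iff.2 hΓ) hact
  | weaklySofic =>
    exact IsApproximable.semidirectProduct finiteFamily_isWreathClosed act hN hΓ hact

theorem GroupClass.mem_of_locallyEmbeddable (𝒞 : GroupClass.{k}) {Λ : Type w} [Group Λ]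
    (h : ∀ F : Finset Λ, ∃ (n : ℕ) (φ : Λ → Equiv.Perm (Fin n)), φ 1 = 1 ∧
      (∀ x ∈ F, ∀ y ∈ F, x * y ∈ F → φ (x * y) = φ x * φ y) ∧ ∀ x ∈ F, x ≠ 1 → φ x ≠ 1) :
    𝒞.Mem Λ := by
  cases 𝒞 with
  | sofic => exact IsApproximable.of_locallyEmbeddable symFamily_isWreathClosed h
  | linearSofic K => exact IsApproximable.of_locallyEmbeddable (glFamily_isWreathClosed K) h
  | hyperlinear =>
    exact isApproximable_unitarySqFamily_iff.1 <|
      IsApproximable.of_locallyEmbeddable unitarySqFamily_isWreathClosed h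
  | weaklySofic => exact IsApproximable.of_locallyEmbeddable finiteFamily_isWreathClosed h

/-! ## Automorphisms of a halo covering permutations of its base -/

section Halo

variable {X : Type u} {G : Type v} [Group G] {L : Set X → Subgroup G}

/-- An element of `L Y` lies in `L Z` for some finite `Z`, hence in `L (Y ∩ Z)` by the intersection
axiom. Condition (a) and `L ∅ = 1` decompose the latter into points. -/
theorem IsHalo.eq_iSup_singleton (hL : IsHalo L) (ha : HaloCondA L) (Y : Set X) :
    L Y = ⨆ y ∈ Y, L {y} := by
  have hfin : ∀ Z : Set X, Z.Finite → L Z ≤ ⨆ z ∈ Z, L {z} := fun Z hZ => by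
    induction Z, hZ using Set.Finite.induction_on with
    | empty => rw [hL.empty]; exact bot_le
    | @insert z Z _ _ ih =>
      rw [Set.insert_eq, ha]
      refine sup_le (le_biSup (fun z => L {z}) (Or.inl rfl)) (ih.trans ?_)
      exact biSup_mono fun x hx => Or.inr hx
  refine le_antisymm (fun x hx => ?_)
    (iSup₂_le fun y hy => hL.mono _ _ (Set.singleton_subset_iff.2 hy))
  have hx' : x ∈ ⨆ Z : {Z : Set X // Z.Finite}, L Z := by
    rw [← hL.iSup_finite, hL.univ]
    trivial
  have : Nonempty {Z : Set X // Z.Finite} := ⟨⟨∅, Set.finite_empty⟩⟩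
  rw [Subgroup.mem_iSup_of_directed fun Z Z' => ⟨⟨Z ∪ Z', Z.2.union Z'.2⟩,
    hL.mono _ _ Set.subset_union_left, hL.mono _ _ Set.subset_union_right⟩] at hx'
  obtain ⟨Z, hZ⟩ := hx'
  have hYZ : x ∈ L (Y ∩ Z) := by
    rw [hL.inter]
    exact ⟨hx, hZ⟩
  have hle : ⨆ z ∈ Y ∩ Z, L {z} ≤ ⨆ z ∈ Y, L {z} := biSup_mono fun _ h => h.1
  exact hle (hfin _ (Z.2.subset Set.inter_subset_right) hYZ)

theorem IsHalo.hom_ext (hL : IsHalo L) (ha : HaloCondA L) {H : Type*} [Group H] {f g : G →* H}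
    (Y : Set X) (h : ∀ x ∈ L Y, f x = g x) (h' : ∀ x ∈ L Yᶜ, f x = g x) : f = g := by
  have : (⊤ : Subgroup G) ≤ f.eqLocus g := by
    rw [← hL.univ, ← Set.union_compl_self Y, ha]
    exact sup_le h h'
  ext x
  exact this trivial

variable {K : Type*} [Group K]

/-- The automorphism `α` of `L(X)` permutes the embedded copies `i x` of the group of a point
according to `σ`. -/
def CoversPerm (i : X → K →* G) (α : MulAut G) (σ : Equiv.Perm X) : Prop :=
  ∀ x k, α (i x k) = i (σ x) k

namespace CoversPerm

variable {i : X → K →* G} {α α' : MulAut G} {σ σ' : Equiv.Perm X}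

theorem one : CoversPerm i 1 1 := fun _ _ => rfl

theorem mul (h : CoversPerm i α σ) (h' : CoversPerm i α' σ') :
    CoversPerm i (α * α') (σ * σ') := fun x k => by
  rw [MulAut.mul_apply, h', h]; rfl

variable (hL : IsHalo L) (ha : HaloCondA L) (hi : ∀ x, (i x).range = L {x})
include hL ha hi

theorem map_eq (h : CoversPerm i α σ) (Y : Set X) : (L Y).map α.toMonoidHom = L (σ '' Y) := by
  rw [hL.eq_iSup_singleton ha Y, hL.eq_iSup_singleton ha (σ '' Y), iSup_image]
  simp_rw [Subgroup.map_iSup, ← hi, ← MonoidHom.range_comp]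
  refine iSup_congr fun x => iSup_congr fun _ => congrArg _ ?_
  ext k
  exact h x k

theorem eqOn (h : CoversPerm i α σ) (h' : CoversPerm i α' σ') {Y : Set X} (hY : Set.EqOn σ σ' Y) :
    ∀ x ∈ L Y, α x = α' x := by
  have : L Y ≤ α.toMonoidHom.eqLocus α'.toMonoidHom := by
    rw [hL.eq_iSup_singleton ha Y]
    refine iSup₂_le fun y hy => ?_
    rw [← hi]
    rintro _ ⟨k, rfl⟩
    exact (h y k).trans ((congrArg (fun z => i z k) (hY hy)).trans (h' y k).symm)
  exact this

theorem conj_mem_autSupportedOn (h : CoversPerm i α σ) {Y : Set X} {β : MulAut G}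
    (hβ : β ∈ autSupportedOn L Y) : α * β * α⁻¹ ∈ autSupportedOn L (σ '' Y) := by
  refine ⟨?_, fun x hx => ?_⟩
  · have e : (α * β * α⁻¹).toMonoidHom.comp α.toMonoidHom =
        α.toMonoidHom.comp β.toMonoidHom := by
      ext x
      change α (β (α⁻¹ (α x))) = α (β x)
      rw [MulAut.inv_apply_self]
    rw [← h.map_eq hL ha hi, Subgroup.map_map, e, ← Subgroup.map_map, hβ.1]
  · rw [← Set.image_compl_eq σ.bijective, ← h.map_eq hL ha hi] at hx
    obtain ⟨y, hy, rfl⟩ := hx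
    change α (β (α⁻¹ (α y))) = α y
    rw [MulAut.inv_apply_self, hβ.2 y hy]

/-- Both conjugates are the identity on the group of the complement of `σ '' Y = σ' '' Y`. On `L (σ
'' Y)` they agree because `α` and `α'` agree on `L Y`, which `β` preserves; the two groups generate
everything. -/
theorem conj_eq_conj (h : CoversPerm i α σ) (h' : CoversPerm i α' σ') {Y : Set X}
    (hY : Set.EqOn σ σ' Y) {β : MulAut G} (hβ : β ∈ autSupportedOn L Y) :
    α * β * α⁻¹ = α' * β * α'⁻¹ := by
  have hY' : σ '' Y = σ' '' Y := hY.image_eq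
  have key : (α * β * α⁻¹).toMonoidHom = (α' * β * α'⁻¹).toMonoidHom := by
    refine hL.hom_ext ha (σ '' Y) (fun x hx => ?_) fun x hx => ?_
    · rw [← h.map_eq hL ha hi] at hx
      obtain ⟨y, hy, rfl⟩ := hx
      have hβy : β y ∈ L Y := by
        rw [← hβ.1]
        exact ⟨y, hy, rfl⟩
      change α (β (α⁻¹ (α y))) = α' (β (α'⁻¹ (α y)))
      rw [MulAut.inv_apply_self, h.eqOn hL ha hi h' hY y hy, MulAut.inv_apply_self,
        h.eqOn hL ha hi h' hY _ hβy]
    · have hx' := hx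
      rw [hY'] at hx'
      exact ((h.conj_mem_autSupportedOn hL ha hi hβ).2 x hx).trans
        ((h'.conj_mem_autSupportedOn hL ha hi hβ).2 x hx').symm
  ext x
  exact DFunLike.congr_fun key x

/-- Conjugation by an automorphism covering a permutation, as an endomorphism of `AL_f(X)`. -/
def conjHom (h : CoversPerm i α σ) : autFin L hL ha →* autFin L hL ha :=
  ((MulAut.conj α).toMonoidHom.comp (autFin L hL ha).subtype).codRestrict _ fun β => by
    obtain ⟨Y, hY, hβ⟩ := β.2
    exact ⟨σ '' Y, hY.image _, h.conj_mem_autSupportedOn hL ha hi hβ⟩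

theorem conjHom_injective (h : CoversPerm i α σ) : Function.Injective (h.conjHom hL ha hi) := by
  intro β γ hβγ
  have : α * β * α⁻¹ = α * γ * α⁻¹ := congrArg Subtype.val hβγ
  exact Subtype.ext (by simpa using this)

end CoversPerm

/-- Induction on `E`: once `σ` is right on `E`, the transposition of `σ x` and `f x` corrects the
value at a new point `x`. It moves no earlier value, by injectivity of `σ` and of `f` on the
enlarged set. -/
theorem exists_coversPerm {i : X → K →* G}
    (hswap : ∀ x y, x ≠ y → ∀ [DecidableEq X], ∃ α, CoversPerm i α (Equiv.swap x y))
    (E : Finset X) (f : X → X) (hf : Set.InjOn f E) :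
    ∃ α σ, CoversPerm i α σ ∧ ∀ x ∈ E, σ x = f x := by
  classical
  induction E using Finset.induction_on with
  | empty => exact ⟨1, 1, .one, by simp⟩
  | insert x E hx ih =>
    obtain ⟨α, σ, h, hσ⟩ := ih (hf.mono (by simp))
    have hτ : ∃ τ, CoversPerm i τ (Equiv.swap (σ x) (f x)) := by
      by_cases hxy : σ x = f x
      · rw [hxy, Equiv.swap_self]
        exact ⟨1, .one⟩
      · exact hswap _ _ hxy
    obtain ⟨τ, hτ⟩ := hτ
    refine ⟨τ * α, _, hτ.mul h, fun y hy => ?_⟩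
    rcases Finset.mem_insert.1 hy with rfl | hy'
    · simp
    · have hyx : y ≠ x := fun h => hx (h ▸ hy')
      have h1 : σ y ≠ σ x := fun h => hyx (σ.injective h)
      have h2 : σ y ≠ f x := fun h => hyx (hf (by simp [hy']) (by simp) (by rw [← hσ y hy', h]))
      rw [Equiv.Perm.mul_apply, Equiv.swap_apply_of_ne_of_ne h1 h2, hσ y hy']

/-! ### Soficity of the conjugation action on finitely supported automorphisms -/

variable {Γ : Type w} [Group Γ] [MulAction Γ X]

/-- The target of a sofic approximation need not fit into a finite `X`, but `Γ` acts through the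
finite group Sym(X). Its left regular representation is an exact model: `θ s` is conjugation by a
lift of `s⁻¹`, and `(g s)⁻¹ g = s⁻¹`. The lifts need not be multiplicative, since conjugation sees
only the permutation. -/
theorem isSoficAutAction_autFinAction_of_finite [Finite X] (hL : IsHalo L) (ha : HaloCondA L)
    (a : Γ →* MulAut G) (h : ∀ (g : Γ) (Y : Set X), (L Y).map (a g).toMonoidHom = L (g • Y))
    {i : X → K →* G} (hi : ∀ x, (i x).range = L {x})
    (hai : ∀ g : Γ, CoversPerm i (a g) (MulAction.toPerm g))
    (hswap : ∀ x y, x ≠ y → ∀ [DecidableEq X], ∃ α, CoversPerm i α (Equiv.swap x y)) :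
    IsSoficAutAction (autFinAction L hL ha a h) := by
  classical
  intro F P ε hε
  have := Fintype.ofFinite X
  have hcov : ∀ σ : Equiv.Perm X, ∃ α, CoversPerm i α σ := fun σ => by
    obtain ⟨α, τ, hα, hτ⟩ := exists_coversPerm hswap Finset.univ σ σ.injective.injOn
    have : τ = σ := Equiv.ext fun x => hτ x (Finset.mem_univ x)
    exact ⟨α, this ▸ hα⟩
  choose α hα using hcov
  -- Transport to `Fin` puts the finite model in the lowest universe, as `IsSoficAutAction` demands.
  let e := Fintype.equivFin (Equiv.Perm X)
  have hmul : ∀ g g' : Γ, e.permCongr (Equiv.mulLeft (MulAction.toPerm (g * g'))) =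
      e.permCongr (Equiv.mulLeft (MulAction.toPerm g)) *
        e.permCongr (Equiv.mulLeft (MulAction.toPerm g')) := fun g g' => by
    ext x
    have : (MulAction.toPerm (g * g') : Equiv.Perm X) =
        MulAction.toPerm g * MulAction.toPerm g' := by ext; simp [mul_smul]
    simp [this]
  refine ⟨Fin (Fintype.card (Equiv.Perm X)), inferInstance,
    fun g => e.permCongr (Equiv.mulLeft (MulAction.toPerm g)), Finset.univ,
    fun s => (hα (e.symm s)⁻¹).conjHom hL ha hi, ?_, ?_, ?_,
    fun s => (hα _).conjHom_injective hL ha hi, ?_⟩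
  · have : (MulAction.toPerm (1 : Γ) : Equiv.Perm X) = 1 := by ext; simp
    ext x
    simp [this]
  · intro g _ g' _ _
    change permDist (e.permCongr (Equiv.mulLeft (MulAction.toPerm (g * g')))) _ < ε
    rw [hmul]
    simpa [permDist] using hε
  · have : (0 : ℝ) < Fintype.card (Fin (Fintype.card (Equiv.Perm X))) := by
      rw [Fintype.card_fin]
      exact_mod_cast Fintype.card_pos
    rw [Finset.card_univ]
    nlinarith
  · intro g _ β _ s _ _
    obtain ⟨Y, -, hβ⟩ := β.2
    have key := ((hα (e.symm (e.permCongr (Equiv.mulLeft (MulAction.toPerm g)) s))⁻¹).mul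
      (hai g)).conj_eq_conj hL ha hi (hα (e.symm s)⁻¹) (Y := Y) (fun x _ => by simp) hβ
    refine Subtype.ext (Eq.trans ?_ key)
    change α _ * (a g * β * (a g)⁻¹) * (α _)⁻¹ = _
    simp only [mul_assoc, mul_inv_rev]

theorem isSoficAutAction_autFinAction_of_infinite [Infinite X] (hL : IsHalo L) (ha : HaloCondA L)
    (a : Γ →* MulAut G) (h : ∀ (g : Γ) (Y : Set X), (L Y).map (a g).toMonoidHom = L (g • Y))
    {i : X → K →* G} (hi : ∀ x, (i x).range = L {x})
    (hai : ∀ g : Γ, CoversPerm i (a g) (MulAction.toPerm g))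
    (hswap : ∀ x y, x ≠ y → ∀ [DecidableEq X], ∃ α, CoversPerm i α (Equiv.swap x y))
    (hΓ : IsSoficAction Γ X) : IsSoficAutAction (autFinAction L hL ha a h) := by
  classical
  intro F P ε hε
  choose Y hYfin hY using fun β : autFin L hL ha => β.2
  -- The orbit condition is applied at `g • x` with `x` in the support of some `β`, so `E` must
  -- contain the supports and their translates by `F`.
  let E : Finset X := P.biUnion fun β => (hYfin β).toFinset ∪
    F.biUnion fun g => (hYfin β).toFinset.image (g • ·)
  have hE1 : ∀ β ∈ P, ∀ x ∈ Y β, x ∈ E := fun β hβ x hx =>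
    Finset.mem_biUnion.2 ⟨β, hβ, Finset.mem_union_left _ ((hYfin β).mem_toFinset.2 hx)⟩
  have hE2 : ∀ β ∈ P, ∀ g ∈ F, ∀ x ∈ Y β, g • x ∈ E := fun β hβ g hg x hx =>
    Finset.mem_biUnion.2 ⟨β, hβ, Finset.mem_union_right _ (Finset.mem_biUnion.2
      ⟨g, hg, Finset.mem_image_of_mem _ ((hYfin β).mem_toFinset.2 hx)⟩)⟩
  obtain ⟨A, _, φ, hφ1, hφ, B, _, S, π, hS, hπ⟩ := hΓ F E ε hε
  -- An arbitrary injection suffices: only equalities between the points `π s x` are used, so any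
  -- structure on `B` may be forgotten.
  let j : B ↪ X := (Finite.equivFin B).toEmbedding.trans
    (Fin.valEmbedding.trans (Infinite.natEmbedding X))
  have hcov : ∀ s : A, ∃ α σ, CoversPerm i α σ ∧
      ∀ (hs : s ∈ S) (x : X) (hx : x ∈ E), σ x = j (π ⟨s, hs⟩ ⟨x, hx⟩) := fun s => by
    by_cases hs : s ∈ S
    · obtain ⟨α, σ, hα, hσ⟩ := exists_coversPerm hswap E
        (fun x => if hx : x ∈ E then j (π ⟨s, hs⟩ ⟨x, hx⟩) else x) fun x hx y hy hxy => by
          simp only [Finset.mem_coe] at hx hy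
          simpa [hx, hy] using hxy
      exact ⟨α, σ, hα, fun _ x hx => by rw [hσ x hx, dif_pos hx]⟩
    · exact ⟨1, 1, .one, fun hs' => absurd hs' hs⟩
  choose α σ hα hσ using hcov
  refine ⟨A, inferInstance, φ, S, fun s => (hα s).conjHom hL ha hi, hφ1, hφ, hS,
    fun s => (hα s).conjHom_injective hL ha hi, fun g hg β hβ s hs hgs => ?_⟩
  have key := ((hα (φ g s)).mul (hai g)).conj_eq_conj hL ha hi (hα s) (Y := Y β)
    (fun x hx => ?_) (hY β)
  · refine Subtype.ext (Eq.trans ?_ key)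
    change α _ * (a g * β * (a g)⁻¹) * (α _)⁻¹ = _
    simp only [mul_assoc, mul_inv_rev]
  · have hx1 := hE1 β hβ x hx
    have hx2 := hE2 β hβ g hg x hx
    change σ (φ g s) (g • x) = σ s x
    rw [hσ _ hgs _ hx2, hσ _ hs _ hx1, hπ g hg (g • x) hx2 (by rwa [inv_smul_smul]) s hs hgs]
    simp only [inv_smul_smul]

theorem isSoficAutAction_autFinAction (hL : IsHalo L) (ha : HaloCondA L)
    (a : Γ →* MulAut G) (h : ∀ (g : Γ) (Y : Set X), (L Y).map (a g).toMonoidHom = L (g • Y))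
    {i : X → K →* G} (hi : ∀ x, (i x).range = L {x})
    (hai : ∀ g : Γ, CoversPerm i (a g) (MulAction.toPerm g))
    (hswap : ∀ x y, x ≠ y → ∀ [DecidableEq X], ∃ α, CoversPerm i α (Equiv.swap x y))
    (hΓ : IsSoficAction Γ X) : IsSoficAutAction (autFinAction L hL ha a h) := by
  cases finite_or_infinite X
  · exact isSoficAutAction_autFinAction_of_finite hL ha a h hi hai hswap
  · exact isSoficAutAction_autFinAction_of_infinite hL ha a h hi hai hswap hΓ

end Halo

/-! ## Residually finite groups -/

theorem finite_monoidHom_of_fg {K Q : Type*} [Group K] [Group Q] [Group.FG K] [Finite Q] :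
    Finite (K →* Q) := by
  obtain ⟨S, hS, hSfin⟩ := Group.fg_iff.1 (inferInstance : Group.FG K)
  have := hSfin.to_subtype
  refine Finite.of_injective (fun (f : K →* Q) (x : S) => f x) fun f g h => ?_
  exact MonoidHom.eq_of_eqOn_dense hS fun x hx => congrFun h ⟨x, hx⟩

theorem residuallyFinite_of_injective {K K' : Type*} [Group K] [Group K']
    [Group.ResiduallyFinite K'] (f : K →* K') (hf : Function.Injective f) :
    Group.ResiduallyFinite K := by
  rw [Group.residuallyFinite_iff_forall_finiteIndexNormalSubgroup]
  intro g hg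
  refine hf ?_
  rw [map_one]
  exact Group.eq_one_iff_forall_finiteIndexNormalSubroup _ fun H => hg (H.comap f)

/-- Finitely many automorphisms of a finitely generated residually finite group are detected by a
finite quotient of the automorphism group. -/
theorem exists_mulAut_hom_perm {K : Type*} [Group K] [Group.FG K] [Group.ResiduallyFinite K]
    (F : Finset (MulAut K)) :
    ∃ (n : ℕ) (ρ : MulAut K →* Equiv.Perm (Fin n)), ∀ β ∈ F, β ≠ 1 → ρ β ≠ 1 := by
  classical
  have hex : ∀ β : MulAut K, ∃ H : FiniteIndexNormalSubgroup K,
      β ≠ 1 → ∃ x, (β x : K ⧸ H.toSubgroup) ≠ x := fun β => by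
    by_cases hβ : β = 1
    · exact ⟨.ofSubgroup ⊤, fun h => absurd hβ h⟩
    · obtain ⟨x, hx⟩ : ∃ x, β x ≠ x := by
        by_contra! h
        exact hβ (MulEquiv.ext h)
      obtain ⟨H, hH⟩ := Group.exists_finiteIndexNormalSubgroup_of_residuallyFinite _ _ hx
      exact ⟨H, fun _ => ⟨x, hH⟩⟩
  choose H hH using hex
  -- `MulAut K` acts by precomposition with the inverse on this product of finite sets of
  -- homomorphisms, finite because `K` is finitely generated. The tuple of quotient maps is moved by
  -- every non-trivial `β ∈ F`, as `β` moves some `x` modulo `H β`.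
  let Ω := ∀ γ : F, K →* K ⧸ (H γ).toSubgroup
  have : ∀ γ : F, Finite (K →* K ⧸ (H γ).toSubgroup) := fun γ => finite_monoidHom_of_fg
  have : Finite Ω := inferInstance
  let act : MulAut K →* Equiv.Perm Ω :=
    { toFun := fun β =>
        { toFun := fun ψ γ => (ψ γ).comp (β⁻¹).toMonoidHom
          invFun := fun ψ γ => (ψ γ).comp β.toMonoidHom
          left_inv := fun ψ => by
            funext γ; ext x
            exact congrArg (ψ γ) (MulAut.inv_apply_self _ _ _)
          right_inv := fun ψ => by
            funext γ; ext x
            exact congrArg (ψ γ) (MulAut.apply_inv_self _ _ _) }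
      map_one' := rfl
      map_mul' := fun β β' => by
        ext ψ γ x
        change ψ γ ((β * β')⁻¹ x) = ψ γ (β'⁻¹ (β⁻¹ x))
        rw [mul_inv_rev]; rfl }
  refine ⟨_, (Finite.equivFin Ω).permCongrHom.toMonoidHom.comp act, fun β hβ hβ1 h => ?_⟩
  have h1 : act β = 1 := by
    apply (Finite.equivFin Ω).permCongrHom.injective
    rw [map_one]
    exact h
  obtain ⟨x, hx⟩ := hH β hβ1
  let ψ : Ω := fun γ => QuotientGroup.mk' _
  have h2 := DFunLike.congr_fun (congrFun (DFunLike.congr_fun h1 ψ) ⟨β, hβ⟩) (β x)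
  change QuotientGroup.mk' (H β).toSubgroup (β⁻¹ (β x)) =
    QuotientGroup.mk' (H β).toSubgroup (β x) at h2
  rw [MulAut.inv_apply_self] at h2
  exact hx h2.symm

/-- The restriction of an automorphism to an invariant subgroup. -/
def MulAut.restrictSubgroup {G : Type*} [Group G] (β : MulAut G) (H : Subgroup G)
    (h : H.map β.toMonoidHom = H) : MulAut H where
  toFun x := ⟨β x, h.le ⟨x, x.2, rfl⟩⟩
  invFun x := ⟨β⁻¹ x, by
    obtain ⟨y, hy, hyx⟩ : (x : G) ∈ H.map β.toMonoidHom := h.symm ▸ x.2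
    rw [← hyx]
    change β⁻¹ (β y) ∈ H
    rwa [MulAut.inv_apply_self]⟩
  left_inv x := Subtype.ext (MulAut.inv_apply_self _ _ _)
  right_inv x := Subtype.ext (MulAut.apply_inv_self _ _ _)
  map_mul' x y := Subtype.ext (map_mul β _ _)

/-- Restriction to `L Z`, for a common finite support `Z` of `F`, is multiplicative and faithful on
`F`, since the elements are the identity on the complementary group. Residual finiteness of the
automorphism group of `L Z` then provides finite models. -/
theorem GroupClass.mem_autFin (𝒞 : GroupClass.{k}) {X : Type u} {G : Type v} [Group G]
    {L : Set X → Subgroup G} (hL : IsHalo L) (ha : HaloCondA L)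
    (hfg : ∀ Y : Set X, Y.Finite → Group.FG (L Y) ∧ Group.ResiduallyFinite (L Y)) :
    𝒞.Mem (autFin L hL ha) := by
  classical
  refine 𝒞.mem_of_locallyEmbeddable fun F => ?_
  choose Y hYfin hY using fun β : autFin L hL ha => β.2
  let Z : Set X := ⋃ β ∈ F, Y β
  have hZfin : Z.Finite := F.finite_toSet.biUnion fun β _ => hYfin β
  have hZ : ∀ β ∈ F, (β : MulAut G) ∈ autSupportedOn L Z := fun β hβ =>
    autSupportedOn_mono hL ha (Set.subset_biUnion_of_mem (u := Y) hβ) (hY β)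
  obtain ⟨_, _⟩ := hfg Z hZfin
  -- The value 1 off the automorphisms supported on `Z` is a mere default: only elements of `F`, and
  -- the identity, are ever evaluated.
  let res : autFin L hL ha → MulAut (L Z) := fun β =>
    if h : (β : MulAut G) ∈ autSupportedOn L Z then
      MulAut.restrictSubgroup (β : MulAut G) (L Z) h.1 else 1
  have hres : ∀ β : autFin L hL ha, (β : MulAut G) ∈ autSupportedOn L Z →
      ∀ x : L Z, (res β x : G) = (β : MulAut G) x := fun β hβ x => by
    simp only [res, dif_pos hβ]
    rfl
  obtain ⟨n, ρ, hρ⟩ := exists_mulAut_hom_perm (F.image res)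
  refine ⟨n, fun β => ρ (res β), ?_, fun β hβ γ hγ hβγ => ?_, fun β hβ hβ1 => ?_⟩
  · have : res 1 = 1 := by
      ext x
      exact hres 1 (autSupportedOn_mono hL ha (Set.empty_subset Z)
        ⟨Subgroup.map_id _, fun _ _ => rfl⟩) x
    show ρ (res 1) = 1
    rw [this, map_one]
  · show ρ (res (β * γ)) = ρ (res β) * ρ (res γ)
    rw [← map_mul]
    congr 1
    ext x
    rw [hres _ (hZ _ hβγ), MulAut.mul_apply, hres _ (hZ _ hβ), hres _ (hZ _ hγ)]
    rfl
  · refine hρ _ (Finset.mem_image_of_mem _ hβ) fun h => hβ1 ?_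
    have key : (β : MulAut G).toMonoidHom = MonoidHom.id G :=
      hL.hom_ext ha Z (fun x hx => by
        have := hres β (hZ β hβ) ⟨x, hx⟩
        rw [h] at this
        exact this.symm) (hZ β hβ).2
    refine Subtype.ext (MulEquiv.ext fun x => DFunLike.congr_fun key x)

theorem fg_and_residuallyFinite_range {K G : Type*} [Group K] [Group G] (f : K →* G)
    (hf : Function.Injective f) (h : Group.FG K ∧ Group.ResiduallyFinite K) :
    Group.FG f.range ∧ Group.ResiduallyFinite f.range := by
  obtain ⟨_, _⟩ := h
  exact ⟨Group.fg_of_surjective f.rangeRestrict_surjective,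
    residuallyFinite_of_injective (MonoidHom.ofInjective hf).symm.toMonoidHom
      (MonoidHom.ofInjective hf).symm.injective⟩

/-! ## Set-theoretic haloes -/

namespace SetHalo

variable (𝓛 : SetHalo.{u, v})

/-- The embedding of the group of a point as the group of `x ∈ X`. -/
def point {X : Type u} (x : X) : 𝓛.obj PUnit.{u + 1} →* 𝓛.obj X :=
  𝓛.map ⟨fun _ => x, fun _ _ _ => rfl⟩

theorem point_range {X : Type u} (x : X) : (𝓛.point x).range = 𝓛.sub {x} := by
  have h1 : 𝓛.point x = (𝓛.map (Function.Embedding.subtype fun y => y ∈ ({x} : Set X))).comp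
      (𝓛.map (Equiv.equivPUnit.{_, u + 1} ({x} : Set X)).symm.toEmbedding) := by
    rw [← 𝓛.map_trans]
    rfl
  have h2 : Function.Surjective
      (𝓛.map (Equiv.equivPUnit.{_, u + 1} ({x} : Set X)).symm.toEmbedding) := fun y =>
    ⟨𝓛.map (Equiv.equivPUnit.{_, u + 1} ({x} : Set X)).toEmbedding y, by
      rw [← MonoidHom.comp_apply, ← 𝓛.map_trans]
      have : (Equiv.equivPUnit.{_, u + 1} ({x} : Set X)).toEmbedding.trans
          (Equiv.equivPUnit.{_, u + 1} ({x} : Set X)).symm.toEmbedding =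
          Function.Embedding.refl _ := by ext; simp
      rw [this, 𝓛.map_refl]
      rfl⟩
  rw [h1, MonoidHom.range_comp, MonoidHom.range_eq_top.2 h2, ← MonoidHom.range_eq_map]
  rfl

theorem coversPerm_mapEquiv {X : Type u} (σ : Equiv.Perm X) :
    CoversPerm 𝓛.point (𝓛.mapEquiv σ) σ := fun x k => by
  change 𝓛.map σ.toEmbedding (𝓛.map _ k) = 𝓛.map _ k
  rw [← MonoidHom.comp_apply, ← 𝓛.map_trans]
  rfl

end SetHalo

/-! ## Graph-theoretic haloes -/

/-- Edges can be forgotten because condition (b) will supply lifts of all transpositions of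
vertices, not only of graph automorphisms. -/
theorem IsSoficGraphAction.isSoficAction {Γ : Type*} [Group Γ] {V : Type*} [MulAction Γ V]
    {X : SimpleGraph V} (h : IsSoficGraphAction Γ X) : IsSoficAction Γ V := fun F E ε hε => by
  obtain ⟨A, hA, φ, h1, h2, W, hW, B, S, π, hS, hπ⟩ := h F E ε hε
  exact ⟨A, hA, φ, h1, h2, W, hW, S, fun s => (π s).toEmbedding, hS, hπ⟩

namespace GraphHalo

variable (𝓛 : GraphHalo.{u, v})

/-- The embedding of a point as a vertex of a graph. -/
def pointEmbedding {V : Type u} (X : SimpleGraph V) (x : V) :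
    (⊥ : SimpleGraph PUnit.{u + 1}) ↪g X where
  toFun _ := x
  inj' _ _ _ := rfl
  map_rel_iff' := by simp

/-- The embedding of the group of a point as the group of a vertex. -/
def point {V : Type u} (X : SimpleGraph V) (x : V) :
    𝓛.obj (⊥ : SimpleGraph PUnit.{u + 1}) →* 𝓛.obj X :=
  𝓛.map (pointEmbedding X x)

theorem map_point {W V : Type u} {Y : SimpleGraph W} {X : SimpleGraph V} (f : Y ↪g X) (y : W)
    (k : 𝓛.obj (⊥ : SimpleGraph PUnit.{u + 1})) :
    𝓛.map f (𝓛.point Y y k) = 𝓛.point X (f y) k := by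
  unfold point
  rw [← MonoidHom.comp_apply, ← 𝓛.map_comp]
  rfl

/-- A singleton is isomorphic to a point, as an induced subgraph. -/
def singletonEmbedding {V : Type u} (X : SimpleGraph V) (x : V) :
    X.induce ({x} : Set V) ↪g (⊥ : SimpleGraph PUnit.{u + 1}) where
  toFun _ := PUnit.unit
  inj' _ _ _ := Subsingleton.elim _ _
  map_rel_iff' := by
    rintro ⟨a, rfl⟩ ⟨b, rfl⟩
    simp

theorem point_range {V : Type u} (X : SimpleGraph V) (x : V) :
    (𝓛.point X x).range = 𝓛.sub X {x} := by
  refine le_antisymm ?_ ?_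
  · rintro _ ⟨k, rfl⟩
    exact ⟨𝓛.point (X.induce ({x} : Set V)) ⟨x, rfl⟩ k, 𝓛.map_point _ _ _⟩
  · rintro _ ⟨k, rfl⟩
    refine ⟨𝓛.map (singletonEmbedding X x) k, ?_⟩
    unfold point
    rw [← MonoidHom.comp_apply, ← 𝓛.map_comp]
    congr 2
    ext ⟨y, rfl⟩
    rfl

theorem coversPerm_action {Γ : Type w} [Group Γ] {V : Type u} [MulAction Γ V] {X : SimpleGraph V}
    (hX : IsGraphAction Γ X) (g : Γ) :
    CoversPerm (𝓛.point X) (𝓛.action hX g) (MulAction.toPerm g) := fun x k =>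
  𝓛.map_point (actIso hX g).toEmbedding x k

/-- The swap of the two vertices of an induced subgraph with two vertices. -/
def swapIso {V : Type u} [DecidableEq V] (X : SimpleGraph V) (x y : V) :
    X.induce ({x, y} : Set V) ≃g X.induce ({x, y} : Set V) where
  toEquiv := Equiv.swap ⟨x, by simp⟩ ⟨y, by simp⟩
  map_rel_iff' := by
    rintro ⟨a, rfl | rfl⟩ ⟨b, rfl | rfl⟩ <;> simp [SimpleGraph.adj_comm]

/-- By condition (b), transpositions of vertices act on `L(X)`, whatever the edges of `X`. -/
theorem exists_coversPerm_swap (hb : 𝓛.CondB) {V : Type u} [DecidableEq V] (X : SimpleGraph V)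
    (x y : V) : ∃ α, CoversPerm (𝓛.point X) α (Equiv.swap x y) := by
  let Y : Set V := {x, y}
  let ι : 𝓛.obj (X.induce Y) →* 𝓛.obj X := 𝓛.map (SimpleGraph.Embedding.induce (G := X) Y)
  let e : 𝓛.obj (X.induce Y) ≃* 𝓛.sub X Y := MonoidHom.ofInjective (𝓛.map_injective _)
  -- Two vertices always induce a graph with a swap symmetry. Functoriality turns it into an
  -- automorphism of the group of `{x, y}`, which (b) extends by the identity on the complement.
  let β : MulAut (𝓛.sub X Y) := (e.symm.trans (𝓛.mapIso (swapIso X x y))).trans e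
  obtain ⟨α, hα, hαβ⟩ := hb V X Y (Set.toFinite Y) β
  have key : ∀ z, ι (𝓛.mapIso (swapIso X x y) z) = α (ι z) := fun z => by
    have h := hαβ (e z)
    change α (ι z) = ι (𝓛.mapIso (swapIso X x y) (e.symm (e z))) at h
    rw [h, MulEquiv.symm_apply_apply]
  refine ⟨α, fun z k => ?_⟩
  by_cases hz : z ∈ Y
  · have h1 : 𝓛.point X z k = ι (𝓛.point (X.induce Y) ⟨z, hz⟩ k) :=
      (𝓛.map_point (SimpleGraph.Embedding.induce (G := X) Y) ⟨z, hz⟩ k).symm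
    have h2 : 𝓛.mapIso (swapIso X x y) (𝓛.point (X.induce Y) ⟨z, hz⟩ k) =
        𝓛.point (X.induce Y) (swapIso X x y ⟨z, hz⟩) k :=
      𝓛.map_point (swapIso X x y).toEmbedding _ _
    have h3 : ((swapIso X x y ⟨z, hz⟩ : Y) : V) = Equiv.swap x y z := by
      rcases hz with rfl | rfl
      · simp [swapIso]
      · simp [swapIso]
    rw [h1, ← key, h2, ← h3]
    exact 𝓛.map_point (SimpleGraph.Embedding.induce (G := X) Y) _ k
  · have hz' : z ≠ x ∧ z ≠ y := by simpa [Y] using hz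
    rw [Equiv.swap_apply_of_ne_of_ne hz'.1 hz'.2]
    refine hα.2 _ ((𝓛.isHalo X).mono {z} Yᶜ (by simpa using hz) ?_)
    exact (𝓛.point_range X z).le ⟨k, rfl⟩

end GraphHalo

/-! ### The main theorem -/

theorem mainTheorem12 (𝒞 : GroupClass.{k}) (Γ : Type w) [Group Γ] (hΓ : 𝒞.Mem Γ) :
    (∀ (X : Type u) [MulAction Γ X], IsSoficAction Γ X →
      ∀ (𝓛 : SetHalo.{u, v}) (ha : 𝓛.CondA), 𝓛.CondB →
        (𝒞.Mem (𝓛.AutFin ha X) → 𝒞.Mem (𝓛.AutEnrichment ha Γ X)) ∧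
        ((∀ Y : Set X, Y.Finite →
            Group.FG (𝓛.obj Y) ∧ Group.ResiduallyFinite (𝓛.obj Y)) →
          𝒞.Mem (𝓛.AutFin ha X) ∧ 𝒞.Mem (𝓛.AutEnrichment ha Γ X))) ∧
    (∀ (V : Type u) (X : SimpleGraph V) [MulAction Γ V] (hX : IsGraphAction Γ X),
      IsSoficGraphAction Γ X →
      ∀ (𝓛 : GraphHalo.{u, v}) (ha : 𝓛.CondA), 𝓛.CondB →
        (𝒞.Mem (𝓛.AutFin ha X) → 𝒞.Mem (𝓛.AutEnrichment ha hX)) ∧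
        ((∀ Y : Set V, Y.Finite →
            Group.FG (𝓛.obj (X.induce Y)) ∧ Group.ResiduallyFinite (𝓛.obj (X.induce Y))) →
          𝒞.Mem (𝓛.AutFin ha X) ∧ 𝒞.Mem (𝓛.AutEnrichment ha hX))) := by
  refine ⟨fun X _ hact 𝓛 ha _ => ?_, fun V X _ hX hact 𝓛 ha hb => ?_⟩
  · have h1 : 𝒞.Mem (𝓛.AutFin ha X) → 𝒞.Mem (𝓛.AutEnrichment ha Γ X) := fun hN =>
      GroupClass.Mem.semidirectProduct _ hN hΓ <|
        isSoficAutAction_autFinAction (𝓛.isHalo X) (ha X) _ _ 𝓛.point_range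
          (fun g => 𝓛.coversPerm_mapEquiv (MulAction.toPerm g))
          (fun x y _ _ => ⟨_, 𝓛.coversPerm_mapEquiv (Equiv.swap x y)⟩) hact
    refine ⟨h1, fun hfg => ?_⟩
    have h2 : 𝒞.Mem (𝓛.AutFin ha X) := 𝒞.mem_autFin (𝓛.isHalo X) (ha X) fun Y hY =>
      fg_and_residuallyFinite_range _ (𝓛.map_injective _) (hfg Y hY)
    exact ⟨h2, h1 h2⟩
  · have h1 : 𝒞.Mem (𝓛.AutFin ha X) → 𝒞.Mem (𝓛.AutEnrichment ha hX) := fun hN =>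
      GroupClass.Mem.semidirectProduct _ hN hΓ <|
        isSoficAutAction_autFinAction (𝓛.isHalo X) (ha V X) _ _ (𝓛.point_range X)
          (𝓛.coversPerm_action hX) (fun x y _ _ => 𝓛.exists_coversPerm_swap hb X x y)
          hact.isSoficAction
    refine ⟨h1, fun hfg => ?_⟩
    have h2 : 𝒞.Mem (𝓛.AutFin ha X) := 𝒞.mem_autFin (𝓛.isHalo X) (ha V X) fun Y hY =>
      fg_and_residuallyFinite_range _ (𝓛.map_injective _) (hfg Y hY)
    exact ⟨h2, h1 h2⟩
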